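/- Let $A$ be a complete regular local ring of dimension $d=2$ with maximal ideal $\mathfrak m$ and residue field $k$, and let $\phi : A \to A$ be a flat local ring endomorphism inducing the identity on $k$. Let $A[X]_\phi$ be the twisted polynomial ring, in which $Xa=\phi(a)X$ for $a\in A$; modules are left modules. For an $A[X]_\phi$-module $M$ the spaces $\mathrm{Tor}_i^A(k,M)$ are $k[X]$-modules through $\mathrm{Tor}_i^A(k,M)\cong\mathrm{Tor}_i^{A[X]_\phi}(k[X],M)$. Put $h_i(M)=\dim_{k(X)}\bigl(k(X)\otimes_{k[X]}\mathrm{Tor}_i^A(k,M)\bigr)$ and $\chi(M)=\sum_{i\ge 0}(-1)^i h_i(M)$. An $A[X]_\phi$-module is smooth if it is locally artinian as an $A$-module (every finitely generated $A$-submodule is artinian), and it is admissible if it is smooth and $\mathrm{Tor}_2^A(k,M)$ is finite-dimensional over $k$. Let $M$ be a smooth finitely presented $A[X]_\phi$-module with $\chi(M)=0$ and $h_0(M)=0$. Then either $M$ is admissible, or there is an $A[X]_\phi$-submodule $\widetilde M\subset M$ that is not finitely generated, such that the quotient map $M\to M/\widetilde M$ induces an isomorphism of $k[X]$-modules from the $k[X]$-torsion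 submodule $\mathrm{Tor}_2^A(k,M)_{\mathrm{tors}}$ of $\mathrm{Tor}_2^A(k,M)$ onto $\mathrm{Tor}_2^A(k,M/\widetilde M)$, and such that the $A[X]_\phi$-module $M/\widetilde M$ is admissible and finitely generated but not finitely presented. -/

import Mathlib

open CategoryTheory TensorProduct Polynomial IsLocalRing

universe u

noncomputable section

/-- The action of the additive monoid `ℕ` on a ring `A` by the iterates of an endomorphism `φ`. -/
@[reducible]
def iterateAction {A : Type u} [CommRing A] (φ : A →+* A) :
    MulSemiringAction (Multiplicative ℕ) A :=
  MulSemiringAction.compHom A (powersHom (A →+* A) φ)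

/-- The twisted polynomial ring `A[X]_φ`: polynomials `∑ aᵢ Xⁱ` with coefficients on the left and
the multiplication determined by `X a = φ(a) X`. -/
def TwistedPolynomial {A : Type u} [CommRing A] (_φ : A →+* A) : Type u :=
  SkewPolynomial A

namespace TwistedPolynomial

variable {A : Type u} [CommRing A] (φ : A →+* A)

instance : Ring (TwistedPolynomial φ) :=
  letI := iterateAction φ
  inferInstanceAs (Ring (SkewMonoidAlgebra A (Multiplicative ℕ)))

/-- The inclusion of the constants `A → A[X]_φ`. -/
def const : A →+* TwistedPolynomial φ :=
  letI := iterateAction φ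
  SkewPolynomial.CRingHom (R := A)

/-- The variable `X` of `A[X]_φ`. -/
def var : TwistedPolynomial φ :=
  SkewPolynomial.X (R := A)

theorem var_mul_const (a : A) : var φ * const φ a = const φ (φ a) * var φ := by
  let := iterateAction φ
  change SkewPolynomial.X (R := A) * SkewPolynomial.C a
    = SkewPolynomial.C (φ a) * SkewPolynomial.X (R := A)
  rw [← SkewPolynomial.monomial_zero_left, SkewPolynomial.X_mul_monomial,
    ← SkewPolynomial.monomial_zero_left, SkewPolynomial.monomial_mul_X]
  rfl

/-- The additive identification of `A[X]_φ` with the polynomials over `A`. -/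
def ofSkew : SkewPolynomial A ≃+ TwistedPolynomial φ where
  toFun p := p
  invFun p := p
  map_add' _ _ := rfl

theorem ofSkew_smul (a : A) (p : SkewPolynomial A) :
    ofSkew φ (a • p) = const φ a * ofSkew φ p := by
  let := iterateAction φ
  have h : a • p = (SkewMonoidAlgebra.single 1 a : SkewPolynomial A) * p := by
    refine SkewMonoidAlgebra.ext_iff.mpr fun n ↦ ?_
    rw [SkewMonoidAlgebra.coeff_single_one_mul]
    rfl
  exact h

end TwistedPolynomial

/-- The underlying `A`-module of an `A[X]_φ`-module. -/
abbrev underlying {A : Type u} [CommRing A] (φ : A →+* A) :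
    ModuleCat.{u} (TwistedPolynomial φ) ⥤ ModuleCat.{u} A :=
  ModuleCat.restrictScalars (TwistedPolynomial.const φ)

section Underlying

variable {A : Type u} [CommRing A] (φ : A →+* A)

instance : (underlying φ).PreservesHomology :=
  Functor.preservesHomology_of_map_exact _ fun S hS ↦ by
    rw [ShortComplex.ShortExact.moduleCat_exact_iff_function_exact] at hS ⊢
    exact hS

theorem projective_of_free_tower (B P : Type u) [Ring B] [AddCommGroup P] [Module A B]
    [Module.Free A B] [Module B P] [Module A P] [IsScalarTower A B B] [IsScalarTower A B P]
    [Module.Projective B P] : Module.Projective A P := by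
  obtain ⟨s, hs⟩ := Module.projective_def'.mp ‹Module.Projective B P›
  have : IsScalarTower A B (P →₀ B) := inferInstance
  exact Module.Projective.of_split (s.restrictScalars A)
    ((Finsupp.linearCombination B (id : P → P)).restrictScalars A)
    (LinearMap.ext fun x ↦ LinearMap.congr_fun hs x)

/-- `A[X]_φ` is free as a left `A`-module, so projective `A[X]_φ`-modules are projective over
`A`. -/
instance : (underlying φ).PreservesProjectiveObjects where
  projective_obj {P} hP := by
    have : Module.Projective (TwistedPolynomial φ) P := (IsProjective.iff_projective P).mpr hP
    let : Module A (TwistedPolynomial φ) := Module.compHom _ (TwistedPolynomial.const φ)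
    let : Module A P := Module.compHom P (TwistedPolynomial.const φ)
    have : IsScalarTower A (TwistedPolynomial φ) P :=
      ⟨fun a r x ↦ mul_smul (TwistedPolynomial.const φ a) r x⟩
    have : IsScalarTower A (TwistedPolynomial φ) (TwistedPolynomial φ) :=
      ⟨fun a r x ↦ mul_assoc (TwistedPolynomial.const φ a) r x⟩
    have : Module.Free A (TwistedPolynomial φ) :=
      Module.Free.of_equiv (M := SkewPolynomial A)
        ((TwistedPolynomial.ofSkew φ).toLinearEquiv (TwistedPolynomial.ofSkew_smul φ))
    have : Module.Projective A P := projective_of_free_tower (TwistedPolynomial φ) P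
    exact (IsProjective.iff_projective (ModuleCat.of A P)).mp this

end Underlying

section Tor

variable (A : Type u) [CommRing A] [IsLocalRing A]

/-- The functor `k ⊗_A -` from `A`-modules to `k`-vector spaces, where `k` is the residue field
of `A`. -/
def residueTensor : ModuleCat.{u} A ⥤ ModuleCat.{u} (ResidueField A) where
  obj M := ModuleCat.of (ResidueField A) (ResidueField A ⊗[A] M)
  map f := ModuleCat.ofHom (f.hom.baseChange (ResidueField A))
  map_id M := by
    ext : 1
    exact LinearMap.baseChange_id
  map_comp f g := by
    ext : 1
    exact LinearMap.baseChange_comp f.hom g.hom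

instance : (residueTensor A).Additive where
  map_add {_ _ f g} := by
    ext : 1
    exact LinearMap.baseChange_add f.hom g.hom

/-- `Tor_i^A(k, -)` with values in `k`-vector spaces: the `i`-th left derived functor of
`k ⊗_A -`. -/
def torResidue (i : ℕ) : ModuleCat.{u} A ⥤ ModuleCat.{u} (ResidueField A) :=
  (residueTensor A).leftDerived i

/-- An `A`-module is locally artinian if its finitely generated submodules are artinian. -/
def IsLocallyArtinian (M : Type u) [AddCommGroup M] [Module A M] : Prop :=
  ∀ N : Submodule A M, N.FG → IsArtinian A N

/-- Admissibility of a module over a regular local ring `A` of dimension `d`: the module is locally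
artinian and `Tor_d^A(k, M)` is finite-dimensional over `k`. -/
def IsAdmissible (d : ℕ) (M : ModuleCat.{u} A) : Prop :=
  IsLocallyArtinian A M ∧ FiniteDimensional (ResidueField A) ((torResidue A d).obj M)

end Tor

section TwistedTor

variable {A : Type u} [CommRing A] [IsLocalRing A] (φ : A →+* A) [IsLocalHom φ]
  (hφ : ResidueField.map φ = RingHom.id (ResidueField A))

/-- The action of `X` on `k ⊗_A M`, namely `c ⊗ m ↦ c ⊗ X m`. It is well defined because `φ`
induces the identity on `k`. -/
def varTensor (M : ModuleCat.{u} (TwistedPolynomial φ)) :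
    ResidueField A ⊗[A] ((underlying φ).obj M) →ₗ[ResidueField A]
      ResidueField A ⊗[A] ((underlying φ).obj M) :=
  LinearMap.liftBaseChange (ResidueField A)
    { toFun := fun m ↦ 1 ⊗ₜ[A] (show (underlying φ).obj M from
        TwistedPolynomial.var φ • (show M from m))
      map_add' := fun m n ↦ by
        rw [← TensorProduct.tmul_add]; congr 1; exact smul_add _ _ _
      map_smul' := fun a m ↦ by
        have h : (TwistedPolynomial.var φ • (show M from a • m)) =
            TwistedPolynomial.const φ (φ a) • (TwistedPolynomial.var φ • (show M from m)) := by
          change TwistedPolynomial.var φ • (TwistedPolynomial.const φ a • (show M from m)) = _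
          rw [smul_smul, smul_smul, TwistedPolynomial.var_mul_const]
        have h' : residue A (φ a) = residue A a := by
          have := congrArg (fun f : ResidueField A →+* ResidueField A ↦ f (residue A a)) hφ
          simpa using this
        rw [h]
        change (1 : ResidueField A) ⊗ₜ[A] (φ a • (show (underlying φ).obj M from
          TwistedPolynomial.var φ • (show M from m))) = _
        rw [TensorProduct.tmul_smul, RingHom.id_apply, TensorProduct.smul_tmul',
          TensorProduct.smul_tmul', Algebra.smul_def, Algebra.smul_def]
        exact congrArg (fun c ↦ (c * 1) ⊗ₜ[A] _) h' }

theorem varTensor_tmul (M : ModuleCat.{u} (TwistedPolynomial φ)) (c : ResidueField A) (m : M) :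
    varTensor φ hφ M (c ⊗ₜ[A] (show (underlying φ).obj M from m)) =
      c ⊗ₜ[A] (show (underlying φ).obj M from TwistedPolynomial.var φ • m) := by
  refine (LinearMap.liftBaseChange_tmul _ _ _ _).trans ?_
  refine (TensorProduct.smul_tmul' _ _ _).trans ?_
  rw [smul_eq_mul, mul_one]

theorem varTensor_naturality {M N : ModuleCat.{u} (TwistedPolynomial φ)} (f : M ⟶ N)
    (x : ResidueField A ⊗[A] ((underlying φ).obj M)) :
    ((underlying φ).map f).hom.baseChange (ResidueField A) (varTensor φ hφ M x) =
      varTensor φ hφ N (((underlying φ).map f).hom.baseChange (ResidueField A) x) := by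
  induction x using TensorProduct.induction_on with
  | zero => simp only [map_zero]
  | add x y hx hy => simp only [map_add, hx, hy]
  | tmul c m =>
    refine (congrArg _ (varTensor_tmul φ hφ M c m)).trans ?_
    refine Eq.trans ?_ (varTensor_tmul φ hφ N c (f.hom m)).symm
    exact congrArg (fun n : (underlying φ).obj N ↦ c ⊗ₜ[A] n) (f.hom.map_smul _ m)

/-- The functor `M ↦ k ⊗_A M` from `A[X]_φ`-modules to `k[X]`-modules, where `X` acts on
`k ⊗_A M` by `c ⊗ m ↦ c ⊗ X m`. This is the functor `k[X] ⊗_{A[X]_φ} -`. -/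
def twistedTensor :
    ModuleCat.{u} (TwistedPolynomial φ) ⥤ ModuleCat.{u} (ResidueField A)[X] where
  obj M := ModuleCat.of _ (Module.AEval' (varTensor φ hφ M))
  map {M N} f := ModuleCat.ofHom <| LinearMap.ofAEval _
    ((Module.AEval'.of (varTensor φ hφ N)).toLinearMap ∘ₗ
      (((underlying φ).map f).hom.baseChange (ResidueField A)))
    (fun x ↦ (congrArg (Module.AEval'.of (varTensor φ hφ N))
      (varTensor_naturality φ hφ f x)).trans (Module.AEval'.X_smul_of _ _).symm)
  map_id M := by
    ext x
    exact LinearMap.congr_fun (LinearMap.baseChange_id (R := A) (A := ResidueField A)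
      (M := (underlying φ).obj M)) x
  map_comp f g := by
    ext x
    exact LinearMap.congr_fun (LinearMap.baseChange_comp (A := ResidueField A)
      ((underlying φ).map f).hom ((underlying φ).map g).hom) x

instance : (twistedTensor φ hφ).Additive where
  map_add {_ _ f g} := by
    ext x
    exact LinearMap.congr_fun (LinearMap.baseChange_add (A := ResidueField A)
      ((underlying φ).map f).hom ((underlying φ).map g).hom) x

/-- The groups `Tor_i^A(k, M)` of an `A[X]_φ`-module `M` with their `k[X]`-module structure: the
`i`-th left derived functor of `k ⊗_A -`, viewed as a functor from `A[X]_φ`-modules to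
`k[X]`-modules, that is, `Tor_i` over `A[X]_φ` of `k[X]` and `M`. By `torTwistedIso` below the
underlying `k`-vector space is `Tor_i^A(k, M)`. -/
def torTwisted (i : ℕ) :
    ModuleCat.{u} (TwistedPolynomial φ) ⥤ ModuleCat.{u} (ResidueField A)[X] :=
  (twistedTensor φ hφ).leftDerived i

/-- Forgetting the action of `X` on `k ⊗_A M`. -/
def twistedTensorIso :
    twistedTensor φ hφ ⋙ ModuleCat.restrictScalars (C : ResidueField A →+* (ResidueField A)[X]) ≅
      underlying φ ⋙ residueTensor A :=
  NatIso.ofComponents (fun M ↦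
    let : Module (ResidueField A) ((twistedTensor φ hφ).obj M) := Module.compHom _ C
    LinearEquiv.toModuleIso
      (X₁ := (twistedTensor φ hφ).obj M)
      (X₂ := ResidueField A ⊗[A] ((underlying φ).obj M))
      { (Module.AEval'.of (varTensor φ hφ M)).symm.toAddEquiv with
        map_smul' := fun c x ↦ by
          refine (Module.AEval.of_symm_smul _ (C c) _).trans ?_
          rw [aeval_C]
          rfl }) (fun f ↦ by rfl)

/-- The `k`-vector space underlying the `k[X]`-module `torTwisted φ hφ i M` is `Tor_i^A(k, M)`. -/
def torTwistedIso (i : ℕ) (M : ModuleCat.{u} (TwistedPolynomial φ)) :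
    (ModuleCat.restrictScalars (C : ResidueField A →+* (ResidueField A)[X])).obj
      ((torTwisted φ hφ i).obj M) ≅ (torResidue A i).obj ((underlying φ).obj M) :=
  let P := projectiveResolution M
  let G := ModuleCat.restrictScalars.{u} (C : ResidueField A →+* (ResidueField A)[X])
  have : G.PreservesHomology := Functor.preservesHomology_of_map_exact _ fun S hS ↦ by
    rw [ShortComplex.ShortExact.moduleCat_exact_iff_function_exact] at hS ⊢
    exact hS
  let K := ((twistedTensor φ hφ).mapHomologicalComplex _).obj P.complex
  G.mapIso (P.isoLeftDerivedObj (twistedTensor φ hφ) i) ≪≫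
    ((K.sc i).mapHomologyIso G).symm ≪≫
    (HomologicalComplex.homologyFunctor _ _ i).mapIso
      ((NatIso.mapHomologicalComplex (twistedTensorIso φ hφ) _).app P.complex) ≪≫
    (((underlying φ).mapProjectiveResolution P).isoLeftDerivedObj (residueTensor A) i).symm

/-- `h_i(M)`: the dimension over `k(X)` of `k(X) ⊗_{k[X]} Tor_i^A(k, M)`. -/
def torRank (i : ℕ) (M : ModuleCat.{u} (TwistedPolynomial φ)) : ℕ :=
  Module.finrank (RatFunc (ResidueField A))
    (RatFunc (ResidueField A) ⊗[(ResidueField A)[X]] ((torTwisted φ hφ i).obj M))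

/-- The Euler-Poincare characteristic `χ(M) = ∑_{i ≥ 0} (-1)^i h_i(M)`. -/
def eulerChar (M : ModuleCat.{u} (TwistedPolynomial φ)) : ℤ :=
  ∑ᶠ i : ℕ, (-1) ^ i * (torRank φ hφ i M : ℤ)

end TwistedTor
end

/-!
Write `R = A[X]_φ`, `T_i(M)` for `Tor_i^A(k, M)` with its `k[X]`-module structure, and let `x`, `y`
generate the maximal ideal of `A`; they form a regular pair (`exists_isRegularPair`).

Three facts about the functors `T_i` carry the argument.

* Chasing elements along a projective resolution of `M` and along the Koszul complex of `x`, `y`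
  gives `T_i(M) = 0` for `i ≥ 3` (`torTwisted_eq_zero`) and a natural additive bijection of `T_2(M)`
  with the socle `{s ∈ M | x s = y s = 0}` (`exists_socleMap`, `SocleMap`). No compatibility with
  `X` is claimed for it, nor needed.
* As `φ` is flat, `R` is left coherent (`TwistedPolynomial.finitePresentation_of_fg`): the relations
  between suitable generators of a finitely generated submodule of a free module are spanned by
  relations of degree at most one. Hence the `T_i(M)` of a finitely presented `M` are finitely
  generated over `k[X]` (`finite_tor_of_finitePresentation`).
* The module `N = R / (R x + R y)` (`TwistedPolynomial.ResidueQuotient`) has the Koszul resolution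
  `0 → R → R ^ 2 → R`, which reduces to a complex with zero differentials over `k[X]`, so that
  `T_2(N)`, `T_1(N)`, `T_0(N)` have ranks `1`, `2` and at most `1`, the first two being free
  (`tor_residueQuotient`). The class in `T_2(N)` that corresponds to the socle element `1` is a
  basis (`SocleMap.exists_basis`).

Now let `χ(M) = 0` and `h_0(M) = 0`. Then `h_1(M) = h_2(M) =: r`. If `r = 0`, the finitely generated
module `T_2(M)` is torsion, so it has finite dimension over `k`, and `M` is admissible.

If `r > 0`, lift a basis of `T_2(M)` modulo torsion to `t_1, …, t_r`. The socle elements of the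
`t_j` define a map `N ^ r → M` which on `T_2` is the inclusion of the span of the `t_j`. Since
every element of `N` is annihilated by a power of the maximal ideal (the ideal generated by `φ(m)`
contains a power of `m`, `maximalIdeal_le_radical_map_of_flat`), a map that is injective on socles
is injective, and `N ^ r` embeds in `M` (`SocleMap.exists_embedding`). In the long exact sequence
for the quotient `M'` of `M` by its image, the torsion of `T_2(M)` maps isomorphically onto the
torsion of `T_2(M')`, which is also the image of `T_2(M)`; moreover `M'` is finitely presented and
`h_1(M') ≤ h_2(M')`, `h_2(M') > 0` (`SocleMap.exists_submodule`). So the construction can be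
repeated, which yields a strictly increasing sequence of submodules of `M`. Its union is not
finitely generated, and every socle element of the quotient by the union is visible at a finite
stage, where the next stage identifies it with a torsion class of `T_2(M)`
(`IsTorsionQuotient.exists_not_fg`). Therefore `T_2` of that quotient is the torsion of `T_2(M)`.
-/

noncomputable section

/-! ### The long exact sequence of left derived functors on modules -/

namespace FreeResolution

open Limits Abelian HomologicalComplex

variable {R : Type u} [Ring R]

instance (M : ModuleCat.{u} R) : Epi ((ModuleCat.adj R).counit.app M) := by
  have h : SplitEpi ((CategoryTheory.forget (ModuleCat.{u} R)).map
      ((ModuleCat.adj R).counit.app M)) :=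
    ⟨_, (ModuleCat.adj R).right_triangle_components M⟩
  have := h.epi
  exact (CategoryTheory.forget (ModuleCat.{u} R)).epi_of_epi_map this

/-- Every module is functorially a quotient of the free module on its underlying set. -/
def cover (R : Type u) [Ring R] : LeftResolution (𝟭 (ModuleCat.{u} R)) where
  F := CategoryTheory.forget _ ⋙ ModuleCat.free R
  π := (ModuleCat.adj R).counit
  epi_π_app M := inferInstanceAs (Epi ((ModuleCat.adj R).counit.app M))

/-- The augmentation of the functorial free resolution. -/
def augmentation (M : ModuleCat.{u} R) : ((cover R).chainComplex M).X 0 ⟶ M :=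
  ((cover R).chainComplexXZeroIso M).hom ≫ (cover R).π.app M

instance (M : ModuleCat.{u} R) : Epi (augmentation M) := epi_comp _ _

theorem exact_augmentation (M : ModuleCat.{u} R) :
    ∃ w, (ShortComplex.mk (((cover R).chainComplex M).d 1 0) (augmentation M) w).Exact := by
  have hd : ((cover R).chainComplex M).d 1 0 = ((cover R).chainComplexXOneIso M).hom ≫
      (cover R).π.app (kernel ((cover R).π.app M)) ≫ kernel.ι ((cover R).π.app M) ≫
        ((cover R).chainComplexXZeroIso M).inv :=
    (cover R).map_chainComplex_d_1_0 M
  have w : ((cover R).chainComplex M).d 1 0 ≫ augmentation M = 0 := by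
    rw [hd]
    simp [augmentation]
  refine ⟨w, ?_⟩
  let α : ShortComplex.mk (((cover R).chainComplex M).d 1 0) (augmentation M) w ⟶
      ShortComplex.mk (kernel.ι ((cover R).π.app M)) _ (kernel.condition _) :=
    { τ₁ := ((cover R).chainComplexXOneIso M).hom ≫ (cover R).π.app (kernel ((cover R).π.app M))
      τ₂ := ((cover R).chainComplexXZeroIso M).hom
      τ₃ := 𝟙 _
      comm₁₂ := by simp [hd]
      comm₂₃ := by simp [augmentation] }
  have : Epi α.τ₁ := epi_comp _ _
  have : IsIso α.τ₂ := inferInstanceAs (IsIso ((cover R).chainComplexXZeroIso M).hom)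
  have : Mono α.τ₃ := inferInstanceAs (Mono (𝟙 _))
  rw [ShortComplex.exact_iff_of_epi_of_isIso_of_mono α]
  exact ShortComplex.exact_of_f_is_kernel _ (kernelIsKernel _)

theorem projective_X (M : ModuleCat.{u} R) :
    ∀ n, Projective (((cover R).chainComplex M).X n)
  | 0 => Projective.of_iso ((cover R).chainComplexXZeroIso M).symm
      (inferInstanceAs (Projective ((ModuleCat.free R).obj _)))
  | 1 => Projective.of_iso ((cover R).chainComplexXOneIso M).symm
      (inferInstanceAs (Projective ((ModuleCat.free R).obj _)))
  | n + 2 => Projective.of_iso ((cover R).chainComplexXIso M n).symm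
      (inferInstanceAs (Projective ((ModuleCat.free R).obj _)))

/-- A projective resolution from an augmented complex of projectives that is exact. -/
def mkResolution {M : ModuleCat.{u} R} (K : ChainComplex (ModuleCat.{u} R) ℕ)
    (hK : ∀ n, Projective (K.X n)) (hex : ∀ n, K.ExactAt (n + 1)) (ε : K.X 0 ⟶ M) [hε : Epi ε]
    (w : K.d 1 0 ≫ ε = 0) (h0 : (ShortComplex.mk _ _ w).Exact) : ProjectiveResolution M where
  complex := K
  π := (ChainComplex.toSingle₀Equiv _ _).symm ⟨ε, w⟩
  quasiIso := ⟨fun n ↦ by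
    cases n
    · rw [ChainComplex.quasiIsoAt₀_iff, ShortComplex.quasiIso_iff_of_zeros']
      · refine (ShortComplex.exact_and_epi_g_iff_of_iso ?_).2 ⟨h0, hε⟩
        exact ShortComplex.isoMk (Iso.refl _) (Iso.refl _) (Iso.refl _)
          (by simp; rfl) (by simp; rfl)
      · exact K.shape _ _ (by simp)
      all_goals rfl
    · rw [quasiIsoAt_iff_exactAt']
      · exact hex _
      · apply ChainComplex.exactAt_succ_single_obj⟩

/-- The functorial free resolution of a module. -/
def resolution (M : ModuleCat.{u} R) : ProjectiveResolution M :=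
  mkResolution ((cover R).chainComplex M) (projective_X M)
    (fun n ↦ (cover R).exactAt_map_chainComplex_succ M n) (augmentation M)
    (exact_augmentation M).choose (exact_augmentation M).choose_spec

theorem resolution_π (M : ModuleCat.{u} R) : (resolution M).π.f 0 = augmentation M :=
  ChainComplex.toSingle₀Equiv_symm_apply_f_zero _ _

theorem map_comp_augmentation {M N : ModuleCat.{u} R} (f : M ⟶ N) :
    ((cover R).chainComplexMap f).f 0 ≫ augmentation N = augmentation M ≫ f := by
  have := (cover R).π_naturality (f := f)
  simp only [Functor.id_map] at this
  simp [augmentation, this]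

/-- The free module functor takes injections between nonempty types to split monomorphisms. -/
theorem isSplitMono_free_map {X Y : Type u} [Nonempty X] (f : X ⟶ Y)
    (hf : Function.Injective f) : IsSplitMono ((ModuleCat.free R).map f) := by
  refine IsSplitMono.mk' ⟨(ModuleCat.free R).map (↾ (Function.invFun f)), ?_⟩
  rw [← Functor.map_comp, ← (ModuleCat.free R).map_id]
  congr 1
  ext x
  exact Function.leftInverse_invFun hf x

theorem isSplitMono_cover_map {M N : ModuleCat.{u} R} (f : M ⟶ N) [Mono f] :
    IsSplitMono ((cover R).F.map f) :=
  isSplitMono_free_map (R := R) ((CategoryTheory.forget (ModuleCat.{u} R)).map f)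
    ((ModuleCat.mono_iff_injective f).mp ‹_›)

/-- The functorial free resolutions turn a monomorphism into a degreewise split one: in each degree
the map is the free functor applied to an injection of underlying sets, here the kernels of the
preceding differentials. -/
theorem isSplitMono_map_f {M N : ModuleCat.{u} R} (f : M ⟶ N) [Mono f] (n : ℕ) :
    IsSplitMono (((cover R).chainComplexMap f).f n) := by
  have key {X Y X' Y' : ModuleCat.{u} R} {p : X ⟶ Y} {q : X' ⟶ Y'} {a : X ⟶ X'} {b : Y ⟶ Y'}
      (w : p ≫ b = a ≫ q) [Mono a] : IsSplitMono ((cover R).F.map (kernel.map p q a b w)) :=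
    have : Mono (kernel.map p q a b w) := by
      have : Mono (kernel.map p q a b w ≫ kernel.ι q) := by
        rw [kernel.lift_ι]
        infer_instance
      exact mono_of_mono _ (kernel.ι q)
    isSplitMono_cover_map _
  induction n using Nat.strong_induction_on with
  | _ n ih =>
    match n, ih with
    | 0, _ =>
      have := isSplitMono_cover_map f
      rw [LeftResolution.chainComplexMap_f_0]
      infer_instance
    | 1, _ =>
      have h0 := isSplitMono_cover_map f
      have : Mono (((cover R).F ⋙ 𝟭 (ModuleCat.{u} R)).map f) :=
        inferInstanceAs (Mono ((cover R).F.map f))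
      have := key ((cover R).π.naturality f).symm
      rw [LeftResolution.chainComplexMap_f_1]
      infer_instance
    | n + 2, ih =>
      have h0 := ih (n + 1) (by lia)
      have : Mono ((𝟭 (ModuleCat.{u} R)).map (((cover R).chainComplexMap f).f (n + 1))) :=
        inferInstanceAs (Mono (((cover R).chainComplexMap f).f (n + 1)))
      rw [LeftResolution.chainComplexMap_f_succ_succ]
      have := key (p := (𝟭 (ModuleCat.{u} R)).map (((cover R).chainComplex M).d (n + 1) n))
        (q := (𝟭 (ModuleCat.{u} R)).map (((cover R).chainComplex N).d (n + 1) n))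
        (a := (𝟭 (ModuleCat.{u} R)).map (((cover R).chainComplexMap f).f (n + 1)))
        (b := (𝟭 (ModuleCat.{u} R)).map (((cover R).chainComplexMap f).f n)) (by simp)
      infer_instance

end FreeResolution

section LongExactSequence

open Limits Abelian HomologicalComplex

/-- Projective resolutions of the terms of a short complex, together with chain maps between them
that lift the given maps and form a degreewise split short complex. -/
structure SplitResolution {C : Type*} [Category* C] [Abelian C] (S : ShortComplex C) where
  /-- the resolution of the first term -/
  P₁ : ProjectiveResolution S.X₁
  /-- the resolution of the second term -/
  P₂ : ProjectiveResolution S.X₂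
  /-- the resolution of the third term -/
  P₃ : ProjectiveResolution S.X₃
  /-- the lift of the first map -/
  f : P₁.complex ⟶ P₂.complex
  /-- the lift of the second map -/
  g : P₂.complex ⟶ P₃.complex
  w : f ≫ g = 0
  /-- the splitting in each degree -/
  splitting (n : ℕ) : ((ShortComplex.mk f g w).map (eval C (ComplexShape.down ℕ) n)).Splitting
  f_comm : f.f 0 ≫ P₂.π.f 0 = P₁.π.f 0 ≫ S.f
  g_comm : g.f 0 ≫ P₃.π.f 0 = P₂.π.f 0 ≫ S.g

namespace SplitResolution

variable {C : Type*} [Category* C] [Abelian C] {S : ShortComplex C}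
  (P : SplitResolution S) {D : Type*} [Category* D] [Abelian D] (F : C ⥤ D) [F.Additive]

/-- The short complex of complexes obtained by applying an additive functor to the resolutions. -/
abbrev mapped : ShortComplex (ChainComplex D ℕ) :=
  ShortComplex.mk ((F.mapHomologicalComplex _).map P.f) ((F.mapHomologicalComplex _).map P.g)
    (by rw [← Functor.map_comp, P.w, Functor.map_zero])

/-- The resolutions stay short exact under an additive functor, being degreewise split. -/
theorem shortExact_mapped : (P.mapped F).ShortExact :=
  shortExact_of_degreewise_shortExact _ fun n ↦ ((P.splitting n).map F).shortExact

variable [HasProjectiveResolutions C]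

/-- The left derived functors of the first term, computed by its resolution. -/
def iso₁ (n : ℕ) : (F.leftDerived n).obj S.X₁ ≅ (P.mapped F).X₁.homology n :=
  P.P₁.isoLeftDerivedObj F n

/-- The left derived functors of the second term, computed by its resolution. -/
def iso₂ (n : ℕ) : (F.leftDerived n).obj S.X₂ ≅ (P.mapped F).X₂.homology n :=
  P.P₂.isoLeftDerivedObj F n

/-- The left derived functors of the third term, computed by its resolution. -/
def iso₃ (n : ℕ) : (F.leftDerived n).obj S.X₃ ≅ (P.mapped F).X₃.homology n :=
  P.P₃.isoLeftDerivedObj F n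

theorem map_f_iso (n : ℕ) : (F.leftDerived n).map S.f ≫ (P.iso₂ F n).hom =
    (P.iso₁ F n).hom ≫ homologyMap (P.mapped F).f n :=
  ProjectiveResolution.isoLeftDerivedObj_hom_naturality S.f P.P₁ P.P₂ P.f P.f_comm F n

theorem map_g_iso (n : ℕ) : (F.leftDerived n).map S.g ≫ (P.iso₃ F n).hom =
    (P.iso₂ F n).hom ≫ homologyMap (P.mapped F).g n :=
  ProjectiveResolution.isoLeftDerivedObj_hom_naturality S.g P.P₂ P.P₃ P.g P.g_comm F n

/-- The connecting morphism of left derived functors. -/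
def δ (n : ℕ) : (F.leftDerived (n + 1)).obj S.X₃ ⟶ (F.leftDerived n).obj S.X₁ :=
  (P.iso₃ F (n + 1)).hom ≫ (P.shortExact_mapped F).δ (n + 1) n rfl ≫ (P.iso₁ F n).inv

theorem exact₂ (P : SplitResolution S) (n : ℕ) : ∃ w,
    (ShortComplex.mk ((F.leftDerived n).map S.f) ((F.leftDerived n).map S.g) w).Exact := by
  have w : (F.leftDerived n).map S.f ≫ (F.leftDerived n).map S.g = 0 := by
    have h := homologyMap_comp (P.mapped F).f (P.mapped F).g n
    rw [(P.mapped F).zero, homologyMap_zero] at h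
    rw [← cancel_mono (P.iso₃ F n).hom, Category.assoc, map_g_iso, ← Category.assoc, map_f_iso,
      Category.assoc, ← h, Limits.comp_zero, Limits.zero_comp]
  exact ⟨w, (ShortComplex.exact_iff_of_iso (ShortComplex.isoMk (P.iso₁ F n) (P.iso₂ F n)
    (P.iso₃ F n) (P.map_f_iso F n).symm (P.map_g_iso F n).symm)).mpr
    ((P.shortExact_mapped F).homology_exact₂ n)⟩

theorem exact₃ (n : ℕ) : ∃ w,
    (ShortComplex.mk ((F.leftDerived (n + 1)).map S.g) (P.δ F n) w).Exact := by
  have w : (F.leftDerived (n + 1)).map S.g ≫ P.δ F n = 0 := by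
    have h := (P.shortExact_mapped F).comp_δ (n + 1) n rfl
    rw [δ, ← Category.assoc, map_g_iso, Category.assoc, ← Category.assoc (homologyMap _ _), h,
      Limits.zero_comp, Limits.comp_zero]
  exact ⟨w, (ShortComplex.exact_iff_of_iso (ShortComplex.isoMk (P.iso₂ F _) (P.iso₃ F _)
    (P.iso₁ F _) (P.map_g_iso F _).symm (by simp [δ]))).mpr
    ((P.shortExact_mapped F).homology_exact₃ (n + 1) n rfl)⟩

theorem exact₁ (n : ℕ) : ∃ w,
    (ShortComplex.mk (P.δ F n) ((F.leftDerived n).map S.f) w).Exact := by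
  have w : P.δ F n ≫ (F.leftDerived n).map S.f = 0 := by
    have h := (P.shortExact_mapped F).δ_comp (n + 1) n rfl
    rw [← cancel_mono (P.iso₂ F n).hom, Category.assoc, map_f_iso, δ, Limits.zero_comp]
    simp [h]
  exact ⟨w, (ShortComplex.exact_iff_of_iso (ShortComplex.isoMk (P.iso₃ F _) (P.iso₁ F _)
    (P.iso₂ F _) (by simp [δ]) (P.map_f_iso F _).symm)).mpr
    ((P.shortExact_mapped F).homology_exact₁ (n + 1) n rfl)⟩

theorem epi_zero (P : SplitResolution S) : Epi ((F.leftDerived 0).map S.g) := by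
  have hE := P.shortExact_mapped F
  have : Epi (P.mapped F).g := hE.epi_g
  have : Epi (homologyMap (P.mapped F).g 0) :=
    epi_homologyMap_of_epi_of_not_rel _ _ (by simp)
  have := P.map_g_iso F 0
  rw [← Iso.eq_comp_inv] at this
  rw [this]
  infer_instance

end SplitResolution

namespace SplitResolution

open FreeResolution

variable {R : Type u} [Ring R]

/-- The cokernel of the map of functorial free resolutions of a short exact sequence. -/
abbrev cokernelComplex {M N : ModuleCat.{u} R} (f : M ⟶ N) : ChainComplex (ModuleCat.{u} R) ℕ :=
  cokernel ((cover R).chainComplexMap f)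

/-- The short complex of functorial free resolutions attached to a map. -/
abbrev resolutionShortComplex {M N : ModuleCat.{u} R} (f : M ⟶ N) :
    ShortComplex (ChainComplex (ModuleCat.{u} R) ℕ) :=
  ShortComplex.mk ((cover R).chainComplexMap f) (cokernel.π _) (cokernel.condition _)

theorem shortExact_resolutionShortComplex {M N : ModuleCat.{u} R} (f : M ⟶ N) [Mono f] :
    (resolutionShortComplex f).ShortExact :=
  have (n : ℕ) : Mono (((cover R).chainComplexMap f).f n) :=
    have := isSplitMono_map_f f n
    inferInstance
  have : Mono (resolutionShortComplex f).f := mono_of_mono_f _ this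
  { exact := ShortComplex.exact_of_g_is_cokernel _ (cokernelIsCokernel _) }

/-- The degreewise splitting of the short complex of free resolutions of a monomorphism. -/
def splittingResolution {M N : ModuleCat.{u} R} (f : M ⟶ N) [Mono f] (n : ℕ) :
    ((resolutionShortComplex f).map (eval _ _ n)).Splitting :=
  have h := (shortExact_resolutionShortComplex f).map_of_exact (eval _ _ n)
  have : IsSplitMono ((resolutionShortComplex f).map (eval _ _ n)).f := isSplitMono_map_f f n
  ShortComplex.Splitting.ofExactOfRetraction _ h.exact
    (retraction ((resolutionShortComplex f).map (eval _ _ n)).f) (IsSplitMono.id _) h.epi_g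

theorem projective_cokernelComplex {M N : ModuleCat.{u} R} (f : M ⟶ N) [Mono f] (n : ℕ) :
    Projective ((cokernelComplex f).X n) :=
  have := projective_X N n
  Retract.projective (Y := ((cover R).chainComplex N).X n)
    { i := (splittingResolution f n).s
      r := ((resolutionShortComplex f).map (eval _ _ n)).g
      retract := (splittingResolution f n).s_g }

theorem chainComplexMap_comp_π {M N : ModuleCat.{u} R} (f : M ⟶ N) :
    (show (resolution M).complex ⟶ (resolution N).complex from (cover R).chainComplexMap f) ≫
      (resolution N).π = (resolution M).π ≫ (ChainComplex.single₀ _).map f := by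
  refine HomologicalComplex.to_single_hom_ext ?_
  rw [comp_f, comp_f, resolution_π, resolution_π, ChainComplex.single₀_map_f_zero]
  exact map_comp_augmentation f

/-- The augmentations of the resolutions in a short exact sequence. -/
def augmentationHom (S : ShortComplex (ModuleCat.{u} R)) :
    resolutionShortComplex S.f ⟶ S.map (ChainComplex.single₀ _) where
  τ₁ := (resolution S.X₁).π
  τ₂ := (resolution S.X₂).π
  τ₃ := cokernel.desc ((cover R).chainComplexMap S.f)
    (show (cover R).chainComplex S.X₂ ⟶ _ from
      (resolution S.X₂).π ≫ (ChainComplex.single₀ _).map S.g) (by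
      have h : (ChainComplex.single₀ _).map S.f ≫ (ChainComplex.single₀ _).map S.g = 0 := by
        rw [← Functor.map_comp, S.zero, Functor.map_zero]
      have h' := chainComplexMap_comp_π S.f =≫ (ChainComplex.single₀ _).map S.g
      rw [Category.assoc, Category.assoc, h, Limits.comp_zero] at h'
      exact h')
  comm₁₂ := (chainComplexMap_comp_π S.f).symm
  comm₂₃ := (cokernel.π_desc _ _ _).symm

/-- The cokernel complex is a projective resolution of the cokernel. -/
def cokernelResolution (S : ShortComplex (ModuleCat.{u} R)) (hS : S.ShortExact) :
    ProjectiveResolution S.X₃ where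
  complex := cokernelComplex S.f
  projective := have := hS.mono_f; projective_cokernelComplex S.f
  π := (augmentationHom S).τ₃
  quasiIso := by
    have := hS.mono_f
    exact HomologySequence.quasiIso_τ₃ (augmentationHom S)
      (shortExact_resolutionShortComplex S.f) (hS.map_of_exact (ChainComplex.single₀ _))
      (resolution S.X₁).quasiIso (resolution S.X₂).quasiIso

/-- A short exact sequence of modules has a degreewise split projective resolution. -/
def ofShortExact (S : ShortComplex (ModuleCat.{u} R)) (hS : S.ShortExact) :
    SplitResolution S where
  P₁ := resolution S.X₁
  P₂ := resolution S.X₂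
  P₃ := cokernelResolution S hS
  f := (cover R).chainComplexMap S.f
  g := cokernel.π ((cover R).chainComplexMap S.f)
  w := cokernel.condition _
  splitting n := have := hS.mono_f; splittingResolution S.f n
  f_comm := by
    rw [resolution_π, resolution_π]
    exact map_comp_augmentation S.f
  g_comm := by
    have := congrArg (fun p ↦ p.f 0) (augmentationHom S).comm₂₃
    exact this.symm

end SplitResolution

end LongExactSequence

/-! ### Regular local rings of dimension two -/

section RegularLocal

variable {A : Type u} [CommRing A]

/-- Two elements of a commutative ring form a regular pair if the Koszul complex of the pair is
exact in positive degrees. -/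
structure IsRegularPair {A : Type*} [CommRing A] (x y : A) : Prop where
  left : ∀ a, a * x = 0 → a = 0
  syzygy : ∀ a b, a * x + b * y = 0 → ∃ w, a = -(w * y) ∧ b = w * x

/-- If the maximal ideal is generated by `x` and `y`, then `x` lies in no prime that is two steps
below the maximal ideal. -/
theorem notMem_of_lt_of_lt [IsLocalRing A] [IsNoetherianRing A] {x y : A}
    (hm : maximalIdeal A = Ideal.span {x, y}) {p q : Ideal A} [p.IsPrime] [q.IsPrime]
    (hpq : p < q) (hq : q < maximalIdeal A) : x ∉ p := by
  intro hx
  have hy : y ∉ q := fun hy ↦ hq.not_ge <| by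
    rw [hm, Ideal.span_le]
    rintro z (rfl | rfl)
    exacts [hpq.le hx, hy]
  -- modulo `p` the maximal ideal is generated by `y`, so `q = p + y q`, and Nakayama applies
  have h : q ≤ p ⊔ maximalIdeal A • q := by
    intro z hz
    have hz' := hq.le hz
    rw [hm, Ideal.mem_span_pair] at hz'
    obtain ⟨a, b, rfl⟩ := hz'
    have hyb : b * y ∈ q := (Submodule.add_mem_iff_right _ (q.mul_mem_left a (hpq.le hx))).mp hz
    have hb : b ∈ q := (‹q.IsPrime›.mem_or_mem hyb).resolve_right hy
    refine Submodule.add_mem_sup (p.mul_mem_left a hx) ?_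
    rw [mul_comm]
    exact Submodule.smul_mem_smul (hm ▸ Ideal.subset_span (by simp)) hb
  exact hpq.not_ge (Submodule.le_of_le_smul_of_le_jacobson_bot (IsNoetherian.noetherian _)
    (IsLocalRing.maximalIdeal_le_jacobson _) h)

/-- By Krull's principal ideal theorem, modulo a prime `p` that is two steps below the maximal ideal
a single element of the maximal ideal does not cut out the closed point. -/
theorem exists_prime_mem_lt_maximalIdeal [IsLocalRing A] [IsNoetherianRing A] (x : A)
    (hx : x ∈ maximalIdeal A) {p q : Ideal A} [p.IsPrime] [q.IsPrime]
    (hpq : p < q) (hq : q < maximalIdeal A) :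
    ∃ P : Ideal A, P.IsPrime ∧ p ≤ P ∧ x ∈ P ∧ P < maximalIdeal A := by
  have hle : p ⊔ Ideal.span {x} ≤ maximalIdeal A :=
    sup_le (hpq.le.trans hq.le) ((Ideal.span_singleton_le_iff_mem _).mpr hx)
  obtain ⟨P, hP, hPm⟩ := Ideal.exists_minimalPrimes_le hle
  have := hP.isPrime
  refine ⟨P, hP.isPrime, le_sup_left.trans hP.le,
    (Ideal.span_singleton_le_iff_mem _).mp (le_sup_right.trans hP.le), lt_of_le_of_ne hPm ?_⟩
  rintro rfl
  have h1 := Ideal.map_height_le_one_of_mem_minimalPrimes hP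
  have hs : Function.Surjective (Ideal.Quotient.mk p) := Ideal.Quotient.mk_surjective
  have key {a b : Ideal A} (ha : p ≤ a) (hb : p ≤ b) (hab : a < b) :
      a.map (Ideal.Quotient.mk p) < b.map (Ideal.Quotient.mk p) :=
    (Ideal.map_mono hab.le).lt_of_not_ge fun e ↦ hab.not_ge <| by
      simpa only [Ideal.comap_map_of_surjective _ hs, ← RingHom.ker_eq_comap_bot, Ideal.mk_ker,
        sup_eq_left.mpr ha, sup_eq_left.mpr hb] using Ideal.comap_mono (f := Ideal.Quotient.mk p) e
  have hk {a : Ideal A} [a.IsPrime] (ha : p ≤ a) : (a.map (Ideal.Quotient.mk p)).IsPrime :=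
    Ideal.map_isPrime_of_surjective hs (by rwa [Ideal.mk_ker])
  have := hk le_rfl
  have := hk hpq.le
  have := hk (hpq.le.trans hq.le)
  have h2 := Ideal.height_add_one_le_of_lt_of_isPrime (key le_rfl hpq.le hpq)
  have h3 := Ideal.height_add_one_le_of_lt_of_isPrime (key hpq.le (hpq.le.trans hq.le) hq)
  have h4 : (0 : ℕ∞) + 1 + 1 ≤ 1 := by
    refine le_trans ?_ (h3.trans h1)
    gcongr
    exact le_trans (by gcongr; exact zero_le) h2
  norm_num at h4

/-- The maximal ideal of a regular local ring of dimension two is generated by a regular pair. Two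
generators `x`, `y` exist by regularity. With primes `p < q < m` and a prime `P` between
`p` and `m` that contains `x`, Nakayama's lemma gives first `P = (x)` and then `p = x p = 0`; so
`A` is a domain and `x` a prime element that does not divide `y`. -/
theorem exists_isRegularPair [IsRegularLocalRing A] (hA : ringKrullDim A = 2) :
    ∃ x y : A, maximalIdeal A = Ideal.span {x, y} ∧ IsRegularPair x y := by
  obtain ⟨s, hs, hspan⟩ := Submodule.FG.exists_span_set_encard_eq_spanFinrank
    (IsNoetherian.noetherian (maximalIdeal A))
  have h2 : (maximalIdeal A).spanFinrank = 2 := by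
    have := IsRegularLocalRing.spanFinrank_maximalIdeal (R := A)
    rw [hA] at this
    exact_mod_cast this
  rw [h2] at hs
  obtain ⟨x, y, -, rfl⟩ := Set.encard_eq_two.mp (by exact_mod_cast hs)
  have hm : maximalIdeal A = Ideal.span {x, y} := hspan.symm
  have hx : x ∈ maximalIdeal A := hm ▸ Ideal.subset_span (by simp)
  obtain ⟨l, hl⟩ := (Order.le_krullDim_iff (α := PrimeSpectrum A) (n := 2)).mp hA.ge
  have h01 : l ⟨0, by lia⟩ < l ⟨1, by lia⟩ := l.strictMono (by simp [Fin.lt_def])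
  have h12 : l ⟨1, by lia⟩ < l ⟨2, by lia⟩ := l.strictMono (by simp [Fin.lt_def])
  have hpq : (l ⟨0, by lia⟩).asIdeal < (l ⟨1, by lia⟩).asIdeal := h01
  have hq : (l ⟨1, by lia⟩).asIdeal < maximalIdeal A :=
    lt_of_lt_of_le (show (l ⟨1, by lia⟩).asIdeal < (l ⟨2, by lia⟩).asIdeal from h12)
      (IsLocalRing.le_maximalIdeal (l ⟨2, by lia⟩).isPrime.ne_top)
  generalize (l ⟨0, by lia⟩) = p at hpq
  generalize (l ⟨1, by lia⟩) = q at hpq hq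
  have hxp : x ∉ p.asIdeal := notMem_of_lt_of_lt hm hpq hq
  obtain ⟨P, hP, hpP, hxP, hPm⟩ := exists_prime_mem_lt_maximalIdeal x hx hpq hq
  have hyP : y ∉ P := fun hy ↦ hPm.not_ge <| by
    rw [hm, Ideal.span_le]
    rintro z (rfl | rfl)
    exacts [hxP, hy]
  have hPx : P ≤ Ideal.span {x} := by
    have h : P ≤ Ideal.span {x} ⊔ maximalIdeal A • P := by
      intro z hz
      have hz' := hPm.le hz
      rw [hm, Ideal.mem_span_pair] at hz'
      obtain ⟨a, b, rfl⟩ := hz'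
      have hyb : b * y ∈ P := (Submodule.add_mem_iff_right _ (P.mul_mem_left a hxP)).mp hz
      have hb : b ∈ P := (hP.mem_or_mem hyb).resolve_right hyP
      refine Submodule.add_mem_sup (Ideal.mul_mem_left _ a (Ideal.mem_span_singleton_self x)) ?_
      rw [mul_comm]
      exact Submodule.smul_mem_smul (hm ▸ Ideal.subset_span (by simp)) hb
    exact Submodule.le_of_le_smul_of_le_jacobson_bot (IsNoetherian.noetherian _)
      (IsLocalRing.maximalIdeal_le_jacobson _) h
  have hp0 : p.asIdeal = ⊥ := by
    refine Submodule.eq_bot_of_le_smul_of_le_jacobson_bot (maximalIdeal A) _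
      (IsNoetherian.noetherian _) ?_ (IsLocalRing.maximalIdeal_le_jacobson _)
    intro z hz
    obtain ⟨a, rfl⟩ := Ideal.mem_span_singleton'.mp (hPx (hpP hz))
    rw [mul_comm]
    exact Submodule.smul_mem_smul hx ((p.isPrime.mem_or_mem hz).resolve_right hxp)
  have hdom : IsDomain A := by
    have := p.isPrime
    rw [hp0] at this
    exact IsDomain.of_bot_isPrime A
  have hx0 : x ≠ 0 := fun h ↦ hxp (h ▸ p.asIdeal.zero_mem)
  refine ⟨x, y, hm, fun a ha ↦ (mul_eq_zero.mp ha).resolve_right hx0, fun a b hab ↦ ?_⟩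
  have hb : b ∈ P := by
    refine (hP.mem_or_mem (?_ : b * y ∈ P)).resolve_right hyP
    rw [← add_eq_zero_iff_neg_eq.mp hab]
    exact P.neg_mem (P.mul_mem_left a hxP)
  obtain ⟨w, rfl⟩ := Ideal.mem_span_singleton'.mp (hPx hb)
  refine ⟨w, ?_, rfl⟩
  have h : (a + w * y) * x = 0 := by rw [← hab]; ring
  exact eq_neg_of_add_eq_zero_left ((mul_eq_zero.mp h).resolve_right hx0)

/-- For a flat local homomorphism that does not raise the dimension, the maximal ideal generates an
ideal with radical the maximal ideal: by going down, a prime containing it has full height. -/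
theorem maximalIdeal_le_radical_map_of_flat {B : Type*} [CommRing B] [IsLocalRing A]
    [IsNoetherianRing A] [IsLocalRing B] [IsNoetherianRing B] (ψ : A →+* B) (hψ : ψ.Flat)
    [IsLocalHom ψ]
    (hdim : ringKrullDim B ≤ ringKrullDim A) :
    maximalIdeal B ≤ ((maximalIdeal A).map ψ).radical := by
  rw [Ideal.radical_eq_sInf]
  refine le_sInf fun P ⟨hP, hPp⟩ ↦ ?_
  algebraize [ψ]
  have hover : P.LiesOver (maximalIdeal A) := by
    refine ⟨le_antisymm (Ideal.map_le_iff_le_comap.mp hP) ?_⟩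
    exact IsLocalRing.le_maximalIdeal (Ideal.IsPrime.under A P).ne_top
  have h1 : (maximalIdeal A).height ≤ P.height := by
    rw [Ideal.height_eq_height_add_of_liesOver_of_hasGoingDown (maximalIdeal A) P]
    exact le_self_add
  have h2 : (maximalIdeal B).height ≤ (maximalIdeal A).height := by
    rw [← IsLocalRing.maximalIdeal_height_eq_ringKrullDim,
      ← IsLocalRing.maximalIdeal_height_eq_ringKrullDim] at hdim
    exact_mod_cast hdim
  by_contra hlt
  have hPm : P < maximalIdeal B :=
    lt_of_le_of_ne (IsLocalRing.le_maximalIdeal hPp.ne_top) (fun h ↦ hlt h.ge)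
  exact absurd (Ideal.height_strict_mono_of_isPrime hPm) (not_lt_of_ge (h2.trans h1))

/-- The kernel of a linear map of free modules commutes with flat base change, in coordinates. -/
theorem exists_eq_sum_of_flat {B : Type*} [CommRing B] (ψ : A →+* B) (hψ : ψ.Flat)
    {ι κ : Type*} [Fintype ι] [DecidableEq ι] [Finite κ] (g : (ι → A) →ₗ[A] (κ → A)) (r : ι → B)
    (hr : ∀ j, ∑ i, r i * ψ (g (Pi.single i 1) j) = 0) :
    ∃ (n : ℕ) (e : Fin n → B) (v : Fin n → ι → A),
      (∀ l, g (v l) = 0) ∧ ∀ i, r i = ∑ l, e l * ψ (v l i) := by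
  classical
  have := Fintype.ofFinite κ
  algebraize [ψ]
  have hex : Function.Exact ((LinearMap.ker g).subtype.lTensor B) (g.lTensor B) :=
    Module.Flat.lTensor_exact B g.exact_subtype_ker_map
  let z : B ⊗[A] (ι → A) := ∑ i, r i ⊗ₜ Pi.single i 1
  have hz : g.lTensor B z = 0 := by
    apply (TensorProduct.piScalarRight A B B κ).injective
    ext j
    simp only [z, map_sum, LinearMap.lTensor_tmul, TensorProduct.piScalarRight_apply,
      TensorProduct.piScalarRightHom_tmul, Finset.sum_apply, map_zero, Pi.zero_apply]
    rw [← hr j]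
    refine Finset.sum_congr rfl fun i _ ↦ ?_
    rw [Algebra.smul_def, mul_comm]
    rfl
  obtain ⟨t, ht⟩ := (hex z).mp hz
  obtain ⟨n, e, w, rfl⟩ : ∃ (n : ℕ) (e : Fin n → B) (w : Fin n → LinearMap.ker g),
      t = ∑ l, e l ⊗ₜ w l := TensorProduct.exists_sum_tmul_eq t
  refine ⟨n, e, fun l ↦ (w l : ι → A), fun l ↦ (w l).2, fun i ↦ ?_⟩
  have h := congrFun (congrArg (TensorProduct.piScalarRight A B B ι) ht) i
  simp only [z, map_sum, LinearMap.lTensor_tmul, TensorProduct.piScalarRight_apply,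
      TensorProduct.piScalarRightHom_tmul, Finset.sum_apply, Submodule.subtype_apply] at h
  rw [Finset.sum_eq_single i (by intro b _ hb; simp [hb.symm]) (by simp)] at h
  rw [Pi.single_eq_same, one_smul] at h
  rw [← h]
  refine Finset.sum_congr rfl fun l _ ↦ ?_
  rw [Algebra.smul_def, mul_comm]
  rfl

end RegularLocal

/-! ### Coefficients of twisted polynomials -/

namespace TwistedPolynomial

variable {A : Type u} [CommRing A] {φ : A →+* A}

/-- The coefficient of `X ^ n`, written on the left. -/
def coeff (n : ℕ) : TwistedPolynomial φ →+ A where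
  toFun r := SkewPolynomial.coeff ((ofSkew φ).symm r) n
  map_zero' := rfl
  map_add' r s := by
    change SkewMonoidAlgebra.coeff _ _ = _
    rw [map_add, SkewMonoidAlgebra.coeff_add]
    rfl

@[ext]
theorem ext {r s : TwistedPolynomial φ} (h : ∀ n, coeff n r = coeff n s) : r = s :=
  (ofSkew φ).symm.injective (SkewMonoidAlgebra.ext_iff.mpr fun n ↦ h n.toAdd)

theorem coeff_const_mul (a : A) (r : TwistedPolynomial φ) (n : ℕ) :
    coeff n (const φ a * r) = a * coeff n r := by
  have h := ofSkew_smul φ a ((ofSkew φ).symm r)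
  rw [AddEquiv.apply_symm_apply] at h
  rw [← h]
  change SkewMonoidAlgebra.coeff (a • (ofSkew φ).symm r) _ = _
  rw [SkewMonoidAlgebra.coeff_smul]
  rfl

theorem const_mul_var_pow (a : A) (n : ℕ) :
    const φ a * var φ ^ n = ofSkew φ (SkewPolynomial.monomial n a) := by
  let := iterateAction φ
  induction n with
  | zero => rw [pow_zero, mul_one]; rfl
  | succ n ih =>
    rw [pow_succ, ← mul_assoc, ih]
    exact SkewPolynomial.monomial_mul_X (R := A) n a

theorem coeff_const_mul_var_pow (a : A) (m n : ℕ) :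
    coeff n (const φ a * var φ ^ m) = if m = n then a else 0 := by
  rw [const_mul_var_pow]
  exact SkewPolynomial.coeff_monomial

theorem exists_coeff_eq_zero (r : TwistedPolynomial φ) : ∃ N, ∀ n, N ≤ n → coeff n r = 0 := by
  obtain ⟨N, hN⟩ := (SkewPolynomial.support ((ofSkew φ).symm r)).bddAbove
  refine ⟨N + 1, fun n hn ↦ ?_⟩
  by_contra h
  exact absurd (hN (Finset.mem_coe.mpr (SkewPolynomial.mem_support_iff.mpr h))) (by lia)

theorem coeff_sum (w : ℕ → A) (N n : ℕ) :
    coeff n (∑ i ∈ Finset.range N, const φ (w i) * var φ ^ i) = if n < N then w n else 0 := by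
  simp only [map_sum, coeff_const_mul_var_pow, Finset.sum_ite_eq', Finset.mem_range]

theorem eq_sum {r : TwistedPolynomial φ} {N : ℕ} (h : ∀ n, N ≤ n → coeff n r = 0) :
    r = ∑ i ∈ Finset.range N, const φ (coeff i r) * var φ ^ i := by
  ext n
  rw [coeff_sum (fun i ↦ coeff i r)]
  split_ifs with hn
  · rfl
  · exact h n (not_lt.mp hn)

theorem var_pow_mul_const (a : A) (n : ℕ) :
    var φ ^ n * const φ a = const φ (φ^[n] a) * var φ ^ n := by
  induction n generalizing a with
  | zero => simp
  | succ n ih =>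
    rw [pow_succ, mul_assoc, var_mul_const, ← mul_assoc, ih, mul_assoc, Function.iterate_succ_apply]

theorem iterate_eq_pow (n : ℕ) : φ^[n] = ⇑(φ ^ n) := (RingHom.coe_pow φ n).symm

theorem coeff_mul_const (r : TwistedPolynomial φ) (a : A) (n : ℕ) :
    coeff n (r * const φ a) = coeff n r * φ^[n] a := by
  obtain ⟨N, hN⟩ := exists_coeff_eq_zero r
  have h : r * const φ a = ∑ i ∈ Finset.range N, const φ (coeff i r * φ^[i] a) * var φ ^ i := by
    conv_lhs => rw [eq_sum hN, Finset.sum_mul]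
    refine Finset.sum_congr rfl fun i _ ↦ ?_
    rw [mul_assoc, var_pow_mul_const, ← mul_assoc, map_mul]
  rw [h, coeff_sum (fun i ↦ coeff i r * φ^[i] a)]
  split_ifs with hn
  · rfl
  · rw [hN n (not_lt.mp hn), zero_mul]

theorem var_pow_mul_eq_sum {r : TwistedPolynomial φ} {N : ℕ} (h : ∀ n, N ≤ n → coeff n r = 0)
    (k : ℕ) : var φ ^ k * r =
      ∑ i ∈ Finset.range N, const φ (φ^[k] (coeff i r)) * var φ ^ (i + k) := by
  conv_lhs => rw [eq_sum h, Finset.mul_sum]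
  refine Finset.sum_congr rfl fun i _ ↦ ?_
  rw [← mul_assoc, var_pow_mul_const, mul_assoc, ← pow_add, add_comm]

theorem coeff_var_pow_mul (r : TwistedPolynomial φ) (k n : ℕ) :
    coeff (n + k) (var φ ^ k * r) = φ^[k] (coeff n r) := by
  obtain ⟨N, hN⟩ := exists_coeff_eq_zero r
  rw [var_pow_mul_eq_sum hN]
  simp only [map_sum, coeff_const_mul_var_pow, add_left_inj, Finset.sum_ite_eq', Finset.mem_range]
  split_ifs with hn
  · rfl
  · rw [hN n (not_lt.mp hn), iterate_eq_pow, map_zero]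

/-- A property of twisted polynomials closed under sums, left multiplication by constants and left
multiplication by the variable holds for all of them once it holds for `1`. -/
theorem induction {p : TwistedPolynomial φ → Prop} (one : p 1)
    (add : ∀ r s, p r → p s → p (r + s)) (const_mul : ∀ a r, p r → p (const φ a * r))
    (var_mul : ∀ r, p r → p (var φ * r)) (r : TwistedPolynomial φ) : p r := by
  have zero : p 0 := by simpa using const_mul 0 1 one
  have pow (n : ℕ) : p (var φ ^ n) := by
    induction n with
    | zero => simpa using one
    | succ n ih => rw [pow_succ']; exact var_mul _ ih
  obtain ⟨N, hN⟩ := exists_coeff_eq_zero r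
  rw [eq_sum hN]
  exact Finset.sum_induction _ p add zero fun i _ ↦ const_mul _ _ (pow i)

end TwistedPolynomial

theorem RingHom.Flat.pow {A : Type*} [CommRing A] {φ : A →+* A} (h : φ.Flat) (n : ℕ) :
    (φ ^ n).Flat := by
  induction n with
  | zero => exact RingHom.Flat.id A
  | succ n ih => exact h.comp ih

/-! ### Flatness of the twisted polynomial ring on the right, and coherence -/

/-- Regular pairs are preserved by flat ring homomorphisms. -/
theorem IsRegularPair.map {A B : Type*} [CommRing A] [CommRing B] {x y : A}
    (h : IsRegularPair x y) (ψ : A →+* B) (hψ : ψ.Flat) : IsRegularPair (ψ x) (ψ y) where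
  left a ha := by
    obtain ⟨n, e, v, hv, hr⟩ := exists_eq_sum_of_flat ψ hψ (ι := Fin 1) (κ := Fin 1)
      (LinearMap.mulRight A (fun _ ↦ x)) (fun _ ↦ a) (fun j ↦ by
        obtain rfl := Subsingleton.elim j 0
        simpa using ha)
    rw [hr 0]
    refine Finset.sum_eq_zero fun l _ ↦ ?_
    rw [h.left (v l 0) (congrFun (hv l) 0), map_zero, mul_zero]
  syzygy a b hab := by
    obtain ⟨n, e, v, hv, hr⟩ := exists_eq_sum_of_flat ψ hψ (ι := Fin 2) (κ := Fin 1)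
      (LinearMap.pi fun _ ↦ LinearMap.lsum A (fun _ ↦ A) A ![LinearMap.mulRight A x,
        LinearMap.mulRight A y]) ![a, b] (fun j ↦ by simpa [Fin.sum_univ_two] using hab)
    have hv' (l) : v l 0 * x + v l 1 * y = 0 := by
      simpa [Fin.sum_univ_two] using congrFun (hv l) 0
    choose w hw0 hw1 using fun l ↦ h.syzygy _ _ (hv' l)
    refine ⟨∑ l, e l * ψ (w l), ?_, ?_⟩
    · refine (hr 0).trans ?_
      rw [Finset.sum_mul, ← Finset.sum_neg_distrib]
      refine Finset.sum_congr rfl fun l _ ↦ ?_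
      rw [hw0, map_neg, map_mul]
      ring
    · refine (hr 1).trans ?_
      rw [Finset.sum_mul]
      refine Finset.sum_congr rfl fun l _ ↦ ?_
      rw [hw1, map_mul]
      ring

namespace TwistedPolynomial

variable {A : Type u} [CommRing A] {φ : A →+* A}

/-- Multiplication on the right by `x` acts on the coefficient of `X ^ n` as multiplication by
`φ ^ n x`, so a regular pair of constants remains one for right multiplication. -/
theorem eq_zero_of_mul_const {x y : A} (h : IsRegularPair x y) (hflat : φ.Flat)
    (r : TwistedPolynomial φ) (hr : r * const φ x = 0) : r = 0 := by
  ext n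
  refine (h.map _ (hflat.pow n)).left _ ?_
  rw [← iterate_eq_pow, ← coeff_mul_const, hr, map_zero]

/-- The right-handed syzygies of a regular pair of constants are the trivial ones. -/
theorem exists_of_mul_const_add {x y : A} (h : IsRegularPair x y) (hflat : φ.Flat)
    (r s : TwistedPolynomial φ) (hrs : r * const φ x + s * const φ y = 0) :
    ∃ w, r = -(w * const φ y) ∧ s = w * const φ x := by
  have key (n : ℕ) : ∃ w, coeff n r = -(w * φ^[n] y) ∧ coeff n s = w * φ^[n] x := by
    rw [iterate_eq_pow]
    refine (h.map _ (hflat.pow n)).syzygy _ _ ?_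
    rw [← iterate_eq_pow, ← coeff_mul_const, ← coeff_mul_const, ← map_add, hrs, map_zero]
  choose w hw1 hw2 using key
  obtain ⟨N, hN⟩ := exists_coeff_eq_zero r
  obtain ⟨N', hN'⟩ := exists_coeff_eq_zero s
  refine ⟨∑ i ∈ Finset.range (max N N'), const φ (w i) * var φ ^ i, ?_, ?_⟩
  · ext n
    rw [map_neg, coeff_mul_const, coeff_sum]
    split_ifs with hn
    · exact hw1 n
    · rw [hN n (by lia), zero_mul, neg_zero]
  · ext n
    rw [coeff_mul_const, coeff_sum]
    split_ifs with hn
    · exact hw2 n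
    · rw [hN' n (by lia), zero_mul]

/-- The vectors of twisted polynomials of degree less than `d`. -/
def degreeLT (φ : A →+* A) (ι : Type*) (d : ℕ) : AddSubgroup (ι → TwistedPolynomial φ) where
  carrier := {v | ∀ i n, d ≤ n → coeff n (v i) = 0}
  zero_mem' _ _ _ := map_zero _
  add_mem' hv hw i n hn := by rw [Pi.add_apply, map_add, hv i n hn, hw i n hn, add_zero]
  neg_mem' hv i n hn := by rw [Pi.neg_apply, map_neg, hv i n hn, neg_zero]

theorem exists_mem_degreeLT {ι : Type*} [Finite ι] (v : ι → TwistedPolynomial φ) :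
    ∃ d, v ∈ degreeLT φ ι d := by
  choose N hN using fun i ↦ exists_coeff_eq_zero (v i)
  obtain ⟨d, hd⟩ := (Set.finite_range N).bddAbove
  exact ⟨d, fun i n hn ↦ hN i n ((hd ⟨i, rfl⟩).trans hn)⟩

/-- Over a noetherian ring, an additive subgroup of vectors of bounded degree stable under the
constants is generated by finitely many elements over the constants. -/
theorem exists_finset_span_of_le_degreeLT [IsNoetherianRing A] {ι : Type*} [Finite ι] (d : ℕ)
    (G : AddSubgroup (ι → TwistedPolynomial φ)) (hG : G ≤ degreeLT φ ι d)
    (hc : ∀ a : A, ∀ v ∈ G, const φ a • v ∈ G) :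
    ∃ (n : ℕ) (g : Fin n → ι → TwistedPolynomial φ), (∀ i, g i ∈ G) ∧
      ∀ v ∈ G, ∃ a : Fin n → A, v = ∑ i, const φ (a i) • g i := by
  let := Module.compHom (ι → TwistedPolynomial φ) (const φ)
  let G' : Submodule A (ι → TwistedPolynomial φ) :=
    { G with smul_mem' := fun a v hv ↦ hc a v hv }
  let L : G' →ₗ[A] (ι × Fin d → A) :=
    { toFun := fun v p ↦ coeff p.2 (v.1 p.1)
      map_add' := fun v w ↦ funext fun p ↦ map_add _ _ _
      map_smul' := fun a v ↦ funext fun p ↦ coeff_const_mul a _ _ }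
  have hL : Function.Injective L := fun v w h ↦ by
    refine Subtype.ext (funext fun i ↦ ext fun n ↦ ?_)
    by_cases hn : n < d
    · exact congrFun h (i, ⟨n, hn⟩)
    · rw [hG v.2 i n (not_lt.mp hn), hG w.2 i n (not_lt.mp hn)]
  have : IsNoetherian A G' := isNoetherian_of_injective L hL
  have : Module.Finite A G' := inferInstance
  obtain ⟨n, s, hs⟩ := Module.Finite.exists_fin (R := A) (M := G')
  refine ⟨n, fun i ↦ (s i).1, fun i ↦ (s i).2, fun v hv ↦ ?_⟩
  have hv' : (⟨v, hv⟩ : G') ∈ Submodule.span A (Set.range s) := hs ▸ Submodule.mem_top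
  obtain ⟨a, ha⟩ := (Submodule.mem_span_range_iff_exists_fun A).mp hv'
  refine ⟨a, ?_⟩
  have := congrArg Subtype.val ha
  rw [AddSubmonoidClass.coe_finsetSum] at this
  exact this.symm

theorem coeff_mul_of_degree_le {r s : TwistedPolynomial φ} {m n : ℕ}
    (hr : ∀ i, m + 1 ≤ i → coeff i r = 0) (hs : ∀ i, n + 1 ≤ i → coeff i s = 0) :
    coeff (m + n) (r * s) = coeff m r * φ^[m] (coeff n s) := by
  conv_lhs => rw [eq_sum hr, Finset.sum_mul, map_sum]
  rw [Finset.sum_range_succ, Finset.sum_eq_zero, zero_add, mul_assoc, coeff_const_mul, add_comm,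
    coeff_var_pow_mul]
  intro i hi
  have hi := Finset.mem_range.mp hi
  rw [mul_assoc, coeff_const_mul, show m + n = (m + n - i) + i by lia, coeff_var_pow_mul,
    hs _ (by lia), iterate_eq_pow, map_zero, mul_zero]

/-- Let `ω` be vectors of degree at most `d` which generate, over the constants, all vectors of
degree at most `d` in the module they span. Then the relations between the `ω j` are spanned by
relations of degree at most one: by flatness the leading coefficients of a relation of degree
`N` come, through `φ ^ N`, from relations between the leading coefficients of the `ω j`, and such
a relation `v` yields the relation `X v - h` of degree one, where `X ∑ v j ω j = ∑ h j ω j`. -/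
theorem mem_span_degreeLT_two (hflat : φ.Flat) {ι σ : Type*} [Finite ι] [Fintype σ] [DecidableEq σ]
    (d : ℕ) (ω : σ → ι → TwistedPolynomial φ)
    (hω : ∀ j, ω j ∈ degreeLT φ ι (d + 1))
    (hspan : ∀ v ∈ Submodule.span (TwistedPolynomial φ) (Set.range ω), v ∈ degreeLT φ ι (d + 1) →
      ∃ a : σ → A, v = ∑ i, const φ (a i) • ω i) (N : ℕ) (r : σ → TwistedPolynomial φ)
    (hr : r ∈ degreeLT φ σ (N + 2)) (hr0 : ∑ j, r j • ω j = 0) :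
    r ∈ Submodule.span (TwistedPolynomial φ)
      {r | r ∈ degreeLT φ σ 2 ∧ ∑ j, r j • ω j = 0} := by
  have := Fintype.ofFinite ι
  induction N generalizing r with
  | zero => exact Submodule.subset_span ⟨hr, hr0⟩
  | succ N ih =>
    have htop (i : ι) : ∑ j, coeff (N + 2) (r j) * (φ ^ (N + 2)) (coeff d (ω j i)) = 0 := by
      have := congrArg (coeff (N + 2 + d)) (congrFun hr0 i)
      simp only [Finset.sum_apply, Pi.smul_apply, smul_eq_mul, Pi.zero_apply, map_sum,
        map_zero] at this
      rw [← this]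
      refine Finset.sum_congr rfl fun j _ ↦ ?_
      rw [coeff_mul_of_degree_le (hr j) (hω j i), iterate_eq_pow]
    obtain ⟨n, e, v, hv, hr'⟩ := exists_eq_sum_of_flat (φ ^ (N + 2)) (hflat.pow _)
      (Fintype.linearCombination A (fun j i ↦ coeff d (ω j i))) (fun j ↦ coeff (N + 2) (r j))
      (fun i ↦ by
        rw [← htop i]
        refine Finset.sum_congr rfl fun j _ ↦ ?_
        rw [Fintype.linearCombination_apply_single, one_smul])
    -- `∑ v j ω j` has degree less than `d`, so its product with `X` has degree at most `d`
    have hg (l : Fin n) : ∃ h : σ → A,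
        var φ • ∑ j, const φ (v l j) • ω j = ∑ j, const φ (h j) • ω j := by
      refine hspan _ (Submodule.smul_mem _ _ (Submodule.sum_mem _ fun j _ ↦ Submodule.smul_mem _ _
        (Submodule.subset_span ⟨j, rfl⟩))) fun i m hm ↦ ?_
      have hz : ∀ m, d ≤ m → coeff m ((∑ j, const φ (v l j) • ω j) i) = 0 := by
        intro m hm
        simp only [Finset.sum_apply, Pi.smul_apply, smul_eq_mul, map_sum, coeff_const_mul]
        obtain rfl | hm := hm.eq_or_lt
        · have := congrFun (hv l) i
          simpa [Fintype.linearCombination_apply] using this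
        · exact Finset.sum_eq_zero fun j _ ↦ by rw [hω j i m hm, mul_zero]
      obtain ⟨m, rfl⟩ : ∃ m', m = m' + 1 := ⟨m - 1, by lia⟩
      rw [Pi.smul_apply, smul_eq_mul, ← pow_one (var φ), coeff_var_pow_mul, hz m (by lia),
        iterate_eq_pow, map_zero]
    choose h hh using hg
    let c (l : Fin n) : σ → TwistedPolynomial φ :=
      fun j ↦ var φ * const φ (v l j) - const φ (h l j)
    have hc0 (l : Fin n) : ∑ j, c l j • ω j = 0 := by
      simp only [c, sub_smul, Finset.sum_sub_distrib, ← hh, Finset.smul_sum, mul_smul, sub_self]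
    have hcdeg (l : Fin n) (j : σ) (m : ℕ) (hm : 1 ≤ m) :
        coeff m (c l j) = if m = 1 then φ (v l j) else 0 := by
      have h1 : c l j = const φ (φ (v l j)) * var φ ^ 1 - const φ (h l j) * var φ ^ 0 := by
        rw [pow_zero, mul_one, pow_one, ← var_mul_const]
      rw [h1, map_sub, coeff_const_mul_var_pow, coeff_const_mul_var_pow, if_neg (by lia : ¬ 0 = m),
        sub_zero]
      simp only [eq_comm]
    -- subtracting left multiples of the relations `c l` removes the leading coefficient of `r`
    let r' := r - ∑ l, (const φ (e l) * var φ ^ (N + 1)) • c l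
    have hr'0 : ∑ j, r' j • ω j = 0 := by
      simp only [r', Pi.sub_apply, sub_smul, Finset.sum_sub_distrib, hr0, Finset.sum_apply,
        Pi.smul_apply, smul_eq_mul, zero_sub, neg_eq_zero, Finset.sum_smul]
      rw [Finset.sum_comm]
      refine Finset.sum_eq_zero fun l _ ↦ ?_
      rw [← smul_zero (const φ (e l) * var φ ^ (N + 1)), ← hc0 l, Finset.smul_sum]
      simp only [mul_smul]
    have hr'deg : r' ∈ degreeLT φ σ (N + 2) := by
      intro j m hm
      simp only [r', Pi.sub_apply, map_sub, Finset.sum_apply, map_sum, Pi.smul_apply, smul_eq_mul]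
      obtain ⟨m, rfl⟩ : ∃ m', m = m' + (N + 1) := ⟨m - (N + 1), by lia⟩
      simp only [mul_assoc, coeff_const_mul, coeff_var_pow_mul, hcdeg _ j m (by lia)]
      obtain rfl | hm' := (show 1 ≤ m by lia).eq_or_lt
      · rw [show 1 + (N + 1) = N + 2 by lia, hr' j, sub_eq_zero]
        refine Finset.sum_congr rfl fun l _ ↦ ?_
        rw [if_pos rfl, ← Function.iterate_succ_apply, iterate_eq_pow]
      · rw [hr j _ (by lia)]
        refine sub_eq_zero.mpr (Finset.sum_eq_zero fun l _ ↦ ?_).symm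
        rw [if_neg (by lia), iterate_eq_pow, map_zero, mul_zero]
    have := ih r' hr'deg hr'0
    rw [show r = r' + ∑ l, (const φ (e l) * var φ ^ (N + 1)) • c l from
      (sub_add_cancel _ _).symm]
    refine Submodule.add_mem _ this (Submodule.sum_mem _ fun l _ ↦ Submodule.smul_mem _ _
      (Submodule.subset_span ⟨fun j m hm ↦ ?_, hc0 l⟩))
    rw [hcdeg l j m (by lia), if_neg (by lia)]

/-- The twisted polynomial ring of a flat endomorphism of a noetherian ring is left coherent. -/
theorem finitePresentation_of_fg [IsNoetherianRing A] (hflat : φ.Flat) {ι : Type*} [Finite ι]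
    (Ω : Submodule (TwistedPolynomial φ) (ι → TwistedPolynomial φ)) (hΩ : Ω.FG) :
    Module.FinitePresentation (TwistedPolynomial φ) Ω := by
  obtain ⟨k, s, rfl⟩ := Submodule.fg_iff_exists_fin_generating_family.mp hΩ
  choose d hd using fun i ↦ exists_mem_degreeLT (s i)
  obtain ⟨D, hD⟩ := (Set.finite_range d).bddAbove
  have hsD (i) : s i ∈ degreeLT φ ι (D + 1) := fun j n hn ↦
    hd i j n ((hD ⟨i, rfl⟩).trans (by lia))
  set Ω := Submodule.span (TwistedPolynomial φ) (Set.range s) with hΩdef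
  obtain ⟨n, ω, hω, hspan⟩ := exists_finset_span_of_le_degreeLT (D + 1)
    (Ω.toAddSubgroup ⊓ degreeLT φ ι (D + 1)) inf_le_right (fun a v hv ↦
      ⟨Ω.smul_mem _ hv.1, fun i n hn ↦ by
        rw [Pi.smul_apply, smul_eq_mul, coeff_const_mul, hv.2 i n hn, mul_zero]⟩)
  have hΩω : Submodule.span (TwistedPolynomial φ) (Set.range ω) = Ω := by
    refine le_antisymm (Submodule.span_le.mpr ?_) (Submodule.span_le.mpr ?_)
    · rintro _ ⟨i, rfl⟩
      exact (hω i).1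
    · rintro _ ⟨i, rfl⟩
      obtain ⟨a, ha⟩ := hspan (s i) ⟨Submodule.subset_span ⟨i, rfl⟩, hsD i⟩
      rw [ha]
      exact Submodule.sum_mem _ fun j _ ↦ Submodule.smul_mem _ _ (Submodule.subset_span ⟨j, rfl⟩)
  let π : (Fin n → TwistedPolynomial φ) →ₗ[TwistedPolynomial φ] (ι → TwistedPolynomial φ) :=
    { toFun := fun r ↦ ∑ j, r j • ω j
      map_add' := fun r s ↦ by simp only [Pi.add_apply, add_smul, Finset.sum_add_distrib]
      map_smul' := fun a r ↦ by
        simp only [Pi.smul_apply, smul_eq_mul, mul_smul, Finset.smul_sum, RingHom.id_apply] }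
  have hrange : LinearMap.range π = Ω := by
    rw [← hΩω]
    ext v
    exact (Submodule.mem_span_range_iff_exists_fun _).symm
  have hker : LinearMap.ker π = Submodule.span (TwistedPolynomial φ)
      {r | r ∈ degreeLT φ (Fin n) 2 ∧ ∑ j, r j • ω j = 0} := by
    refine le_antisymm (fun r hr ↦ ?_) (Submodule.span_le.mpr fun r hr ↦ hr.2)
    obtain ⟨N, hN⟩ := exists_mem_degreeLT r
    exact mem_span_degreeLT_two hflat D ω (fun j ↦ (hω j).2)
      (fun v hv hvD ↦ hspan v ⟨hΩω ▸ hv, hvD⟩) N r (fun i n hn ↦ hN i n (by lia)) hr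
  obtain ⟨m, g, hg, hgspan⟩ := exists_finset_span_of_le_degreeLT 2
    ((LinearMap.ker π).toAddSubgroup ⊓ degreeLT φ (Fin n) 2) inf_le_right (fun a v hv ↦
      ⟨(LinearMap.ker π).smul_mem _ hv.1, fun i n hn ↦ by
        rw [Pi.smul_apply, smul_eq_mul, coeff_const_mul, hv.2 i n hn, mul_zero]⟩)
  have hfg : (LinearMap.ker π).FG := by
    rw [Submodule.fg_iff_exists_fin_generating_family]
    refine ⟨m, g, le_antisymm (Submodule.span_le.mpr ?_) ?_⟩
    · rintro _ ⟨i, rfl⟩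
      exact (hg i).1
    · rw [hker]
      refine Submodule.span_le.mpr fun r hr ↦ ?_
      obtain ⟨a, rfl⟩ := hgspan r ⟨hr.2, hr.1⟩
      exact Submodule.sum_mem _ fun j _ ↦ Submodule.smul_mem _ _ (Submodule.subset_span ⟨j, rfl⟩)
  rw [← hrange]
  refine Module.finitePresentation_of_surjective π.rangeRestrict π.surjective_rangeRestrict ?_
  rwa [LinearMap.ker_rangeRestrict]

end TwistedPolynomial

/-! ### Cycles representing elements of left derived functors -/

section Represents

variable {S : Type*} [Ring S]

/-- The homology class `h` is the class of the cycle `z`. -/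
def HomologicalComplex.Represents (K : ChainComplex (ModuleCat.{u} S) ℕ) (n : ℕ) (z : K.X n)
    (h : K.homology n) : Prop :=
  ∃ c : K.cycles n, (K.iCycles n).hom c = z ∧ (K.homologyπ n).hom c = h

namespace HomologicalComplex.Represents

variable {K L : ChainComplex (ModuleCat.{u} S) ℕ} {n : ℕ}

theorem sub {z z' : K.X n} {h h' : K.homology n} (H : K.Represents n z h)
    (H' : K.Represents n z' h') : K.Represents n (z - z') (h - h') := by
  obtain ⟨c, hc, hc'⟩ := H
  obtain ⟨d, hd, hd'⟩ := H'
  exact ⟨c - d, by rw [map_sub, hc, hd], by rw [map_sub, hc', hd']⟩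

theorem map (f : K ⟶ L) {z : K.X n} {h : K.homology n} (H : K.Represents n z h) :
    L.Represents n ((f.f n).hom z) ((HomologicalComplex.homologyMap f n).hom h) := by
  obtain ⟨c, rfl, rfl⟩ := H
  refine ⟨(HomologicalComplex.cyclesMap f n).hom c, ?_, ?_⟩
  · exact ConcreteCategory.congr_hom (HomologicalComplex.cyclesMap_i f n) c
  · exact (ConcreteCategory.congr_hom (HomologicalComplex.homologyπ_naturality f n) c).symm

theorem exists_cycle (h : K.homology (n + 1)) :
    ∃ z, (K.d (n + 1) n).hom z = 0 ∧ K.Represents (n + 1) z h := by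
  obtain ⟨c, rfl⟩ := (ModuleCat.epi_iff_surjective (K.homologyπ (n + 1))).mp inferInstance h
  exact ⟨(K.iCycles _).hom c, ConcreteCategory.congr_hom (K.iCycles_d (n + 1) n) c, c, rfl, rfl⟩

theorem exists_class (z : K.X (n + 1)) (hz : (K.d (n + 1) n).hom z = 0) :
    ∃ h, K.Represents (n + 1) z h := by
  have hex := ShortComplex.exact_of_f_is_kernel
    (ShortComplex.mk (K.iCycles (n + 1)) (K.d (n + 1) n) (K.iCycles_d _ _))
    (K.cyclesIsKernel (n + 1) n (ChainComplex.next_nat_succ n))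
  obtain ⟨c, hc⟩ := (ShortComplex.moduleCat_exact_iff _).mp hex z hz
  exact ⟨_, c, hc, rfl⟩

theorem exists_boundary {z : K.X n} (H : K.Represents n z 0) :
    ∃ b, (K.d (n + 1) n).hom b = z := by
  obtain ⟨c, rfl, hc⟩ := H
  have hex := ShortComplex.exact_of_g_is_cokernel
    (ShortComplex.mk (K.toCycles (n + 1) n) (K.homologyπ n) (K.toCycles_comp_homologyπ _ _))
    (K.homologyIsCokernel (n + 1) n (ChainComplex.prev _ n))
  obtain ⟨b, rfl⟩ := (ShortComplex.moduleCat_exact_iff _).mp hex c hc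
  exact ⟨b, (ConcreteCategory.congr_hom (K.toCycles_i (n + 1) n) b).symm⟩

theorem eq_zero_of_boundary {z : K.X n} {h : K.homology n} (H : K.Represents n z h)
    (b : K.X (n + 1)) (hb : (K.d (n + 1) n).hom b = z) : h = 0 := by
  obtain ⟨c, rfl, rfl⟩ := H
  have : c = (K.toCycles (n + 1) n).hom b := by
    refine (ModuleCat.mono_iff_injective (K.iCycles n)).mp inferInstance ?_
    rw [← hb]
    exact (ConcreteCategory.congr_hom (K.toCycles_i (n + 1) n) b).symm
  rw [this]
  exact ConcreteCategory.congr_hom (K.toCycles_comp_homologyπ (n + 1) n) b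

end HomologicalComplex.Represents

end Represents

/-! ### Elementwise description of a projective resolution -/

namespace CategoryTheory.ProjectiveResolution

variable {R : Type u} [Ring R] {M : ModuleCat.{u} R} (P : ProjectiveResolution M)

/-- The augmentation `P₀ → M`. -/
def augmentation : P.complex.X 0 →ₗ[R] M := (P.π.f 0).hom

theorem augmentation_surjective : Function.Surjective P.augmentation :=
  (ModuleCat.epi_iff_surjective (P.π.f 0)).mp inferInstance

theorem augmentation_d (p : P.complex.X 1) : P.augmentation ((P.complex.d 1 0).hom p) = 0 :=
  ConcreteCategory.congr_hom P.complex_d_comp_π_f_zero p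

theorem exists_d_eq_of_augmentation_eq_zero (p : P.complex.X 0) (h : P.augmentation p = 0) :
    ∃ p', (P.complex.d 1 0).hom p' = p :=
  (ShortComplex.moduleCat_exact_iff _).mp P.exact₀ p h

theorem exists_d_eq {n : ℕ} (p : P.complex.X (n + 1)) (h : (P.complex.d (n + 1) n).hom p = 0) :
    ∃ p', (P.complex.d (n + 2) (n + 1)).hom p' = p :=
  (ShortComplex.moduleCat_exact_iff _).mp (P.exact_succ n) p h

theorem d_d {n : ℕ} (p : P.complex.X (n + 2)) :
    (P.complex.d (n + 1) n).hom ((P.complex.d (n + 2) (n + 1)).hom p) = 0 :=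
  ConcreteCategory.congr_hom (P.complex.d_comp_d _ _ _) p

end CategoryTheory.ProjectiveResolution

/-! ### Regular pairs acting on projective modules -/

section Koszul

variable {A : Type u} [CommRing A] {x y : A}

theorem IsRegularPair.eq_zero_of_smul_eq_zero (h : IsRegularPair x y) {N : Type u} [AddCommGroup N]
    [Module A N] [Module.Projective A N] (p : N) (hp : x • p = 0) : p = 0 := by
  obtain ⟨s, hs⟩ := Module.projective_def'.mp ‹Module.Projective A N›
  have h0 : s p = 0 := Finsupp.ext fun i ↦ h.left _ <| by
    have := DFunLike.congr_fun (congrArg s hp) i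
    rw [map_smul, map_zero] at this
    simpa [mul_comm] using this
  rw [← LinearMap.id_apply (R := A) p, ← hs, LinearMap.comp_apply, h0, map_zero]

/-- The Koszul complex of a regular pair is exact in the middle after tensoring with a projective
module. -/
theorem IsRegularPair.exists_of_smul_add_smul_eq_zero (h : IsRegularPair x y) {N : Type u}
    [AddCommGroup N] [Module A N] [Module.Projective A N] (p q : N) (hpq : x • p + y • q = 0) :
    ∃ w, p = -(y • w) ∧ q = x • w := by
  obtain ⟨s, hs⟩ := Module.projective_def'.mp ‹Module.Projective A N›
  have hs' (n : N) : Finsupp.linearCombination A id (s n) = n := LinearMap.congr_fun hs n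
  have key (i : N) : s p i * x + s q i * y = 0 := by
    have := DFunLike.congr_fun (congrArg s hpq) i
    rw [map_add, map_smul, map_smul, map_zero] at this
    simpa [mul_comm] using this
  choose w hw1 hw2 using fun i ↦ h.syzygy _ _ (key i)
  let w' : N →₀ A := Finsupp.onFinset (s q).support w fun i hi ↦ by
    rw [Finsupp.mem_support_iff, hw2]
    exact fun h0 ↦ hi (h.left _ h0)
  refine ⟨Finsupp.linearCombination A id w', ?_, ?_⟩
  · rw [← hs' p, ← map_smul, ← map_neg]
    congr 1
    ext i
    simp [w', hw1, mul_comm]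
  · rw [← hs' q, ← map_smul]
    congr 1
    ext i
    simp [w', hw2, mul_comm]

end Koszul

/-! ### The map from a module to its reduction -/

theorem Submodule.exists_of_mem_span_pair_smul_top {A N : Type*} [CommRing A] [AddCommGroup N]
    [Module A N] {x y : A} {n : N} (hn : n ∈ (Ideal.span {x, y} • ⊤ : Submodule A N)) :
    ∃ p q : N, n = x • p + y • q := by
  refine Submodule.smul_induction_on hn (fun a ha m _ ↦ ?_) ?_
  · obtain ⟨b, c, rfl⟩ := Ideal.mem_span_pair.mp ha
    exact ⟨b • m, c • m, by rw [add_smul, smul_smul, smul_smul, mul_comm x, mul_comm y]⟩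
  · rintro _ _ ⟨p, q, rfl⟩ ⟨p', q', rfl⟩
    exact ⟨p + p', q + q', by rw [smul_add, smul_add]; abel⟩

section ResidueTensor

variable {A N : Type*} [CommRing A] [IsLocalRing A] [AddCommGroup N] [Module A N]

theorem IsLocalRing.one_tmul_smul (a : A) (n : N) :
    (1 : ResidueField A) ⊗ₜ[A] (a • n) = residue A a • ((1 : ResidueField A) ⊗ₜ[A] n) := by
  rw [TensorProduct.tmul_smul, TensorProduct.smul_tmul', TensorProduct.smul_tmul',
    Algebra.smul_def, smul_eq_mul]
  rfl

theorem IsLocalRing.exists_one_tmul_eq (t : ResidueField A ⊗[A] N) :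
    ∃ n : N, (1 : ResidueField A) ⊗ₜ[A] n = t := by
  induction t using TensorProduct.induction_on with
  | zero => exact ⟨0, TensorProduct.tmul_zero _ _⟩
  | add s t hs ht =>
    obtain ⟨a, rfl⟩ := hs
    obtain ⟨b, rfl⟩ := ht
    exact ⟨a + b, TensorProduct.tmul_add _ _ _⟩
  | tmul c n =>
    obtain ⟨a, rfl⟩ := residue_surjective c
    refine ⟨a • n, ?_⟩
    rw [one_tmul_smul, TensorProduct.smul_tmul', smul_eq_mul, mul_one]

theorem IsLocalRing.mem_smul_top_of_one_tmul_eq_zero {n : N}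
    (h : (1 : ResidueField A) ⊗ₜ[A] n = 0) : n ∈ (maximalIdeal A • ⊤ : Submodule A N) := by
  have h2 : TensorProduct.quotTensorEquivQuotSMul N (maximalIdeal A)
      ((1 : A ⧸ maximalIdeal A) ⊗ₜ[A] n) = 0 := (LinearEquiv.map_eq_zero_iff _).mpr h
  rw [← Submodule.Quotient.mk_eq_zero, ← h2]
  exact (TensorProduct.quotTensorEquivQuotSMul_mk_one_tmul _ _).symm

end ResidueTensor

theorem Module.AEval'.C_smul_of {S N : Type*} [CommRing S] [AddCommGroup N] [Module S N]
    (f : N →ₗ[S] N) (c : S) (n : N) :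
    (C c : S[X]) • Module.AEval'.of f n = Module.AEval'.of f (c • n) := by
  exact (Module.AEval.C_smul f c (Module.AEval'.of f n)).trans
    ((Module.AEval'.of f).map_smul c n).symm

section TensorMk

variable {A : Type u} [CommRing A] [IsLocalRing A] (φ : A →+* A) [IsLocalHom φ]
  (hφ : ResidueField.map φ = RingHom.id (ResidueField A))

/-- The map `N → k ⊗_A N`, `n ↦ 1 ⊗ n`. -/
def tensorMk (N : ModuleCat.{u} (TwistedPolynomial φ)) : N →+ (twistedTensor φ hφ).obj N where
  toFun n := Module.AEval'.of (varTensor φ hφ N) (1 ⊗ₜ[A] (show (underlying φ).obj N from n))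
  map_zero' := (congrArg _ (TensorProduct.tmul_zero _ _)).trans (map_zero _)
  map_add' _ _ := (congrArg _ (TensorProduct.tmul_add _ _ _)).trans (map_add _ _ _)

variable {φ}

theorem map_tensorMk {M N : ModuleCat.{u} (TwistedPolynomial φ)} (f : M ⟶ N) (m : M) :
    ((twistedTensor φ hφ).map f).hom (tensorMk φ hφ M m) = tensorMk φ hφ N (f.hom m) := rfl

theorem tensorMk_var_smul (N : ModuleCat.{u} (TwistedPolynomial φ)) (n : N) :
    tensorMk φ hφ N (TwistedPolynomial.var φ • n) =
      (X : (ResidueField A)[X]) • tensorMk φ hφ N n :=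
  (congrArg (Module.AEval'.of (varTensor φ hφ N)) (varTensor_tmul φ hφ N 1 n).symm).trans
    (Module.AEval'.X_smul_of (varTensor φ hφ N) _).symm

theorem tensorMk_const_smul (N : ModuleCat.{u} (TwistedPolynomial φ)) (a : A) (n : N) :
    tensorMk φ hφ N (TwistedPolynomial.const φ a • n) =
      (C (residue A a) : (ResidueField A)[X]) • tensorMk φ hφ N n :=
  (congrArg (Module.AEval'.of (varTensor φ hφ N))
    (one_tmul_smul a (show (underlying φ).obj N from n))).trans
    (Module.AEval'.C_smul_of (varTensor φ hφ N) (residue A a) _).symm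

theorem tensorMk_surjective (N : ModuleCat.{u} (TwistedPolynomial φ)) :
    Function.Surjective (tensorMk φ hφ N) :=
  (Module.AEval'.of (varTensor φ hφ N)).surjective.comp
    (exists_one_tmul_eq (N := (underlying φ).obj N))

theorem tensorMk_const_smul_eq_zero {x : A} (hx : x ∈ maximalIdeal A)
    (N : ModuleCat.{u} (TwistedPolynomial φ)) (n : N) :
    tensorMk φ hφ N (TwistedPolynomial.const φ x • n) = 0 := by
  rw [tensorMk_const_smul, (residue_eq_zero_iff x).mpr hx, map_zero, zero_smul]

theorem exists_of_tensorMk_eq_zero {x y : A} (hxy : maximalIdeal A = Ideal.span {x, y})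
    (N : ModuleCat.{u} (TwistedPolynomial φ)) {n : N} (h : tensorMk φ hφ N n = 0) :
    ∃ p q : N, n = TwistedPolynomial.const φ x • p + TwistedPolynomial.const φ y • q := by
  have h' := mem_smul_top_of_one_tmul_eq_zero (n := (show (underlying φ).obj N from n))
    ((Module.AEval'.of (varTensor φ hφ N)).map_eq_zero_iff.mp h)
  rw [hxy] at h'
  exact Submodule.exists_of_mem_span_pair_smul_top h'

end TensorMk

/-! ### The second Tor group and the socle -/

section Projective

open TwistedPolynomial

variable {A : Type u} [CommRing A] {φ : A →+* A} {x y : A}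

theorem projective_underlying (N : ModuleCat.{u} (TwistedPolynomial φ)) [Projective N] :
    Module.Projective A ((underlying φ).obj N) :=
  (IsProjective.iff_projective ((underlying φ).obj N)).mpr
    (show Projective ((underlying φ).obj N) from inferInstance)

theorem IsRegularPair.eq_zero_of_const_smul_eq_zero (h : IsRegularPair x y)
    (N : ModuleCat.{u} (TwistedPolynomial φ)) [Projective N] {p : N} (hp : const φ x • p = 0) :
    p = 0 :=
  have := projective_underlying N
  h.eq_zero_of_smul_eq_zero (N := (underlying φ).obj N) p hp

theorem IsRegularPair.exists_of_const_smul_add_const_smul_eq_zero (h : IsRegularPair x y)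
    (N : ModuleCat.{u} (TwistedPolynomial φ)) [Projective N] {p q : N}
    (hpq : const φ x • p + const φ y • q = 0) : ∃ w, p = -(const φ y • w) ∧ q = const φ x • w :=
  have := projective_underlying N
  h.exists_of_smul_add_smul_eq_zero (N := (underlying φ).obj N) p q hpq

theorem TwistedPolynomial.const_smul_comm {N : Type*} [AddCommGroup N]
    [Module (TwistedPolynomial φ) N] (a b : A) (n : N) :
    const φ a • const φ b • n = const φ b • const φ a • n := by
  rw [smul_smul, smul_smul, ← map_mul, ← map_mul, mul_comm]

/-- Two successive applications of the exactness of the Koszul complex on the terms of a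
resolution. -/
theorem exists_d_eq_koszul {M : ModuleCat.{u} (TwistedPolynomial φ)} {P : ProjectiveResolution M}
    (hreg : IsRegularPair x y) {n : ℕ} {p q : P.complex.X (n + 1)}
    {z : P.complex.X (n + 2)}
    (h : (P.complex.d (n + 2) (n + 1)).hom z = const φ x • p + const φ y • q) :
    ∃ w, (P.complex.d (n + 1) n).hom p = -(const φ y • w) ∧
      (P.complex.d (n + 1) n).hom q = const φ x • w := by
  refine hreg.exists_of_const_smul_add_const_smul_eq_zero _ ?_
  rw [← map_smul, ← map_smul, ← map_add, ← h, P.d_d]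

end Projective

section Represents

open TwistedPolynomial

variable {A : Type u} [CommRing A] [IsLocalRing A] {φ : A →+* A} [IsLocalHom φ]
  (hφ : ResidueField.map φ = RingHom.id (ResidueField A))
  {M N : ModuleCat.{u} (TwistedPolynomial φ)} (P : ProjectiveResolution M)
  (Q : ProjectiveResolution N)

/-- The terms of a resolution mapped to the terms of its reduction. -/
def reduction (n : ℕ) : P.complex.X n →+
    (((twistedTensor φ hφ).mapHomologicalComplex (ComplexShape.down ℕ)).obj P.complex).X n :=
  tensorMk φ hφ (P.complex.X n)

/-- `Tor_n(k, M)` computed from a projective resolution of `M`. -/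
def torEquiv (n : ℕ) : (torTwisted φ hφ n).obj M ≃ₗ[(ResidueField A)[X]]
    (((twistedTensor φ hφ).mapHomologicalComplex (ComplexShape.down ℕ)).obj P.complex).homology n :=
  (P.isoLeftDerivedObj (twistedTensor φ hφ) n).toLinearEquiv

/-- The chain `z` of a projective resolution of `M` becomes after reduction a cycle whose class is
the element `t` of `Tor_n(k, M)`. -/
def TorRepresents (n : ℕ) (z : P.complex.X n) (t : (torTwisted φ hφ n).obj M) : Prop :=
  HomologicalComplex.Represents _ n (reduction hφ P n z) (torEquiv hφ P n t)

variable {hφ P Q} {x y : A} {n : ℕ}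

theorem d_reduction (z : P.complex.X (n + 1)) :
    ((((twistedTensor φ hφ).mapHomologicalComplex (ComplexShape.down ℕ)).obj P.complex).d
      (n + 1) n).hom (reduction hφ P (n + 1) z) =
      reduction hφ P n ((P.complex.d (n + 1) n).hom z) := rfl

theorem reduction_surjective : Function.Surjective (reduction hφ P n) :=
  tensorMk_surjective hφ _

theorem reduction_eq_zero (hxy : maximalIdeal A = Ideal.span {x, y}) (p q : P.complex.X n) :
    reduction hφ P n (const φ x • p + const φ y • q) = 0 := by
  have hx : x ∈ maximalIdeal A := hxy ▸ Ideal.subset_span (by simp)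
  have hy : y ∈ maximalIdeal A := hxy ▸ Ideal.subset_span (by simp)
  rw [map_add]
  exact (congrArg₂ (· + ·) (tensorMk_const_smul_eq_zero hφ hx _ p)
    (tensorMk_const_smul_eq_zero hφ hy _ q)).trans (add_zero _)

theorem exists_of_reduction_eq_zero (hxy : maximalIdeal A = Ideal.span {x, y})
    {z : P.complex.X n} (hz : reduction hφ P n z = 0) :
    ∃ p q, z = const φ x • p + const φ y • q :=
  exists_of_tensorMk_eq_zero hφ hxy _ hz

theorem TorRepresents.sub {z z' : P.complex.X n} {t t' : (torTwisted φ hφ n).obj M}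
    (H : TorRepresents hφ P n z t) (H' : TorRepresents hφ P n z' t') :
    TorRepresents hφ P n (z - z') (t - t') := by
  unfold TorRepresents
  rw [map_sub, map_sub]
  exact HomologicalComplex.Represents.sub H H'

theorem TorRepresents.map (f : M ⟶ N) {z : P.complex.X n} {t : (torTwisted φ hφ n).obj M}
    (H : TorRepresents hφ P n z t) :
    TorRepresents hφ Q n (((ProjectiveResolution.lift f P Q).f n).hom z)
      (((torTwisted φ hφ n).map f).hom t) := by
  have h := HomologicalComplex.Represents.map
    (((twistedTensor φ hφ).mapHomologicalComplex (ComplexShape.down ℕ)).map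
      (ProjectiveResolution.lift f P Q)) H
  have h2 := ConcreteCategory.congr_hom (ProjectiveResolution.isoLeftDerivedObj_hom_naturality f P Q
    (ProjectiveResolution.lift f P Q) (ProjectiveResolution.lift_commutes_zero f P Q)
    (twistedTensor φ hφ) n) t
  have h3 : torEquiv hφ Q n (((torTwisted φ hφ n).map f).hom t) =
      (HomologicalComplex.homologyMap
        (((twistedTensor φ hφ).mapHomologicalComplex (ComplexShape.down ℕ)).map
          (ProjectiveResolution.lift f P Q)) n).hom (torEquiv hφ P n t) := h2
  unfold TorRepresents
  rw [h3]
  exact h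

theorem TorRepresents.exists_cycle (hxy : maximalIdeal A = Ideal.span {x, y})
    (t : (torTwisted φ hφ (n + 1)).obj M) :
    ∃ z p q, (P.complex.d (n + 1) n).hom z = const φ x • p + const φ y • q ∧
      TorRepresents hφ P (n + 1) z t := by
  obtain ⟨z', hz', H⟩ := HomologicalComplex.Represents.exists_cycle (torEquiv hφ P (n + 1) t)
  obtain ⟨z, rfl⟩ := reduction_surjective z'
  rw [d_reduction] at hz'
  obtain ⟨p, q, h⟩ := exists_of_reduction_eq_zero hxy hz'
  exact ⟨z, p, q, h, H⟩

theorem TorRepresents.exists_class (hxy : maximalIdeal A = Ideal.span {x, y})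
    {z : P.complex.X (n + 1)} {p q : P.complex.X n}
    (h : (P.complex.d (n + 1) n).hom z = const φ x • p + const φ y • q) :
    ∃ t, TorRepresents hφ P (n + 1) z t := by
  obtain ⟨t, H⟩ := HomologicalComplex.Represents.exists_class (reduction hφ P (n + 1) z) (by
    rw [d_reduction, h, reduction_eq_zero hxy])
  refine ⟨(torEquiv hφ P (n + 1)).symm t, ?_⟩
  unfold TorRepresents
  rwa [LinearEquiv.apply_symm_apply]

theorem TorRepresents.eq_zero (hxy : maximalIdeal A = Ideal.span {x, y})
    {z : P.complex.X n} {t : (torTwisted φ hφ n).obj M} (H : TorRepresents hφ P n z t)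
    (b : P.complex.X (n + 1)) (p q : P.complex.X n)
    (h : z = const φ x • p + const φ y • q + (P.complex.d (n + 1) n).hom b) : t = 0 := by
  have h0 := HomologicalComplex.Represents.eq_zero_of_boundary H (reduction hφ P _ b) (by
    rw [d_reduction, h, map_add, reduction_eq_zero hxy, zero_add])
  exact (torEquiv hφ P n).map_eq_zero_iff.mp h0

theorem TorRepresents.exists_boundary (hxy : maximalIdeal A = Ideal.span {x, y})
    {z : P.complex.X n} (H : TorRepresents hφ P n z 0) :
    ∃ b p q, z = const φ x • p + const φ y • q + (P.complex.d (n + 1) n).hom b := by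
  unfold TorRepresents at H
  rw [map_zero] at H
  obtain ⟨b', hb'⟩ := HomologicalComplex.Represents.exists_boundary H
  obtain ⟨b, rfl⟩ := reduction_surjective b'
  rw [d_reduction] at hb'
  obtain ⟨p, q, h⟩ := exists_of_reduction_eq_zero hxy
    (z := z - (P.complex.d (n + 1) n).hom b) (by rw [map_sub, hb', sub_self])
  exact ⟨b, p, q, by rw [← h, sub_add_cancel]⟩

end Represents

section Chase

open TwistedPolynomial

variable {A : Type u} [CommRing A] [IsLocalRing A] {φ : A →+* A} [IsLocalHom φ]
  {hφ : ResidueField.map φ = RingHom.id (ResidueField A)}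
  {M N : ModuleCat.{u} (TwistedPolynomial φ)} {P : ProjectiveResolution M}
  {Q : ProjectiveResolution N} {x y : A} {n : ℕ}

/-- If the chain reached from a cycle after two steps along the Koszul complex is a boundary
`d v`, then the class of the cycle vanishes: the corrections `p + y v` and `q - x v` are boundaries,
and subtracting them exhibits the cycle as a boundary modulo the maximal ideal. -/
theorem TorRepresents.eq_zero_of_koszul (hxy : maximalIdeal A = Ideal.span {x, y})
    {p q v : P.complex.X (n + 1)} {z : P.complex.X (n + 2)}
    {t : (torTwisted φ hφ (n + 2)).obj M} (H : TorRepresents hφ P (n + 2) z t)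
    (h : (P.complex.d (n + 2) (n + 1)).hom z = const φ x • p + const φ y • q)
    (hp : (P.complex.d (n + 1) n).hom p = -(const φ y • (P.complex.d (n + 1) n).hom v))
    (hq : (P.complex.d (n + 1) n).hom q = const φ x • (P.complex.d (n + 1) n).hom v) : t = 0 := by
  obtain ⟨p', hp'⟩ := P.exists_d_eq (p + const φ y • v) (by
    rw [map_add, map_smul, hp, neg_add_cancel])
  obtain ⟨q', hq'⟩ := P.exists_d_eq (q - const φ x • v) (by
    rw [map_sub, map_smul, hq, sub_self])
  obtain ⟨b, hb⟩ := P.exists_d_eq (z - const φ x • p' - const φ y • q') (by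
    rw [map_sub, map_sub, map_smul, map_smul, hp', hq', h, smul_add, smul_sub,
      const_smul_comm x y]
    abel)
  exact H.eq_zero hxy b p' q' (by rw [hb]; abel)

/-- `Tor_n(k, M)` vanishes above the dimension. -/
theorem torTwisted_eq_zero (hxy : maximalIdeal A = Ideal.span {x, y}) (hreg : IsRegularPair x y)
    (M : ModuleCat.{u} (TwistedPolynomial φ)) (n : ℕ) (t : (torTwisted φ hφ (n + 3)).obj M) :
    t = 0 := by
  obtain ⟨z, p, q, h, H⟩ := TorRepresents.exists_cycle (P := projectiveResolution M) hxy t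
  obtain ⟨w, hp, hq⟩ := exists_d_eq_koszul hreg h
  have hw : ((projectiveResolution M).complex.d (n + 1) n).hom w = 0 := by
    refine hreg.eq_zero_of_const_smul_eq_zero _ ?_
    rw [← map_smul, ← hq, ProjectiveResolution.d_d]
  obtain ⟨v, rfl⟩ := (projectiveResolution M).exists_d_eq w hw
  exact H.eq_zero_of_koszul hxy h hp hq

/-- The relation underlying the isomorphism of `Tor_2(k, M)` with the socle of `M`: descending
along a resolution of `M` and along the Koszul complex, a chain representing `t` leads to the
element `s` of `M`. -/
def IsSocleClass (hφ : ResidueField.map φ = RingHom.id (ResidueField A)) (x y : A)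
    (P : ProjectiveResolution M) (t : (torTwisted φ hφ 2).obj M) (s : M) : Prop :=
  ∃ z p q w, TorRepresents hφ P 2 z t ∧
    (P.complex.d 2 1).hom z = const φ x • p + const φ y • q ∧
    (P.complex.d 1 0).hom p = -(const φ y • w) ∧
    (P.complex.d 1 0).hom q = const φ x • w ∧ P.augmentation w = s

namespace IsSocleClass

theorem sub {t t' : (torTwisted φ hφ 2).obj M} {s s' : M} (H : IsSocleClass hφ x y P t s)
    (H' : IsSocleClass hφ x y P t' s') : IsSocleClass hφ x y P (t - t') (s - s') := by
  obtain ⟨z, p, q, w, h1, h2, h3, h4, rfl⟩ := H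
  obtain ⟨z', p', q', w', h1', h2', h3', h4', rfl⟩ := H'
  refine ⟨z - z', p - p', q - q', w - w', h1.sub h1', ?_, ?_, ?_, map_sub _ _ _⟩
  · rw [map_sub, h2, h2', smul_sub, smul_sub]; abel
  · rw [map_sub, h3, h3', smul_sub]; abel
  · rw [map_sub, h4, h4', smul_sub]

theorem map (f : M ⟶ N) {t : (torTwisted φ hφ 2).obj M} {s : M}
    (H : IsSocleClass hφ x y P t s) :
    IsSocleClass hφ x y Q (((torTwisted φ hφ 2).map f).hom t) (f.hom s) := by
  obtain ⟨z, p, q, w, h1, h2, h3, h4, rfl⟩ := H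
  have hd (i j : ℕ) (v : P.complex.X i) : (Q.complex.d i j).hom
      (((ProjectiveResolution.lift f P Q).f i).hom v) =
      ((ProjectiveResolution.lift f P Q).f j).hom ((P.complex.d i j).hom v) :=
    ConcreteCategory.congr_hom ((ProjectiveResolution.lift f P Q).comm i j) v
  refine ⟨_, ((ProjectiveResolution.lift f P Q).f 1).hom p,
    ((ProjectiveResolution.lift f P Q).f 1).hom q, ((ProjectiveResolution.lift f P Q).f 0).hom w,
    h1.map f, ?_, ?_, ?_, ?_⟩
  · rw [hd, h2, map_add, map_smul, map_smul]
  · rw [hd, h3, map_neg, map_smul]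
  · rw [hd, h4, map_smul]
  · exact ConcreteCategory.congr_hom (ProjectiveResolution.lift_commutes_zero f P Q) w

theorem exists_socle (hxy : maximalIdeal A = Ideal.span {x, y}) (hreg : IsRegularPair x y)
    (t : (torTwisted φ hφ 2).obj M) : ∃ s, IsSocleClass hφ x y P t s := by
  obtain ⟨z, p, q, h, H⟩ := TorRepresents.exists_cycle (P := P) hxy t
  obtain ⟨w, hp, hq⟩ := exists_d_eq_koszul hreg h
  exact ⟨_, z, p, q, w, H, h, hp, hq, rfl⟩

theorem smul_eq_zero {t : (torTwisted φ hφ 2).obj M} {s : M} (H : IsSocleClass hφ x y P t s) :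
    const φ x • s = 0 ∧ const φ y • s = 0 := by
  obtain ⟨z, p, q, w, -, -, h3, h4, rfl⟩ := H
  constructor
  · rw [← map_smul, ← h4, P.augmentation_d]
  · rw [← neg_eq_zero, ← map_smul, ← map_neg, ← h3, P.augmentation_d]

theorem exists_class (hxy : maximalIdeal A = Ideal.span {x, y}) {s : M}
    (hx : const φ x • s = 0) (hy : const φ y • s = 0) : ∃ t, IsSocleClass hφ x y P t s := by
  obtain ⟨w, rfl⟩ := P.augmentation_surjective s
  obtain ⟨q, hq⟩ := P.exists_d_eq_of_augmentation_eq_zero (const φ x • w) (by rw [map_smul, hx])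
  obtain ⟨p, hp⟩ := P.exists_d_eq_of_augmentation_eq_zero (-(const φ y • w)) (by
    rw [map_neg, map_smul, hy, neg_zero])
  obtain ⟨z, hz⟩ := P.exists_d_eq (const φ x • p + const φ y • q) (by
    rw [map_add, map_smul, map_smul, hp, hq, smul_neg, const_smul_comm x y, neg_add_cancel])
  obtain ⟨t, ht⟩ := TorRepresents.exists_class (hφ := hφ) hxy hz
  exact ⟨t, z, p, q, w, ht, hz, hp, hq, rfl⟩

theorem eq_zero_left (hxy : maximalIdeal A = Ideal.span {x, y})
    {t : (torTwisted φ hφ 2).obj M} (H : IsSocleClass hφ x y P t 0) : t = 0 := by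
  obtain ⟨z, p, q, w, h1, h2, h3, h4, h5⟩ := H
  obtain ⟨v, rfl⟩ := P.exists_d_eq_of_augmentation_eq_zero w h5
  exact h1.eq_zero_of_koszul hxy h2 h3 h4

/-- The socle element attached to a class does not depend on the choices. -/
theorem eq_zero_right (hxy : maximalIdeal A = Ideal.span {x, y}) (hreg : IsRegularPair x y)
    {s : M} (H : IsSocleClass hφ x y P 0 s) : s = 0 := by
  obtain ⟨z, p, q, w, h1, h2, h3, h4, rfl⟩ := H
  obtain ⟨b, a, a', rfl⟩ := h1.exists_boundary hxy
  rw [map_add, P.d_d, add_zero, map_add, map_smul, map_smul] at h2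
  obtain ⟨c, -, hc⟩ := hreg.exists_of_const_smul_add_const_smul_eq_zero _
    (p := p - (P.complex.d 2 1).hom a) (q := q - (P.complex.d 2 1).hom a') (by
      rw [smul_sub, smul_sub, ← add_sub_add_comm, ← h2, sub_self])
  have hw : w = (P.complex.d 1 0).hom c := by
    rw [← sub_eq_zero]
    refine hreg.eq_zero_of_const_smul_eq_zero _ ?_
    rw [smul_sub, ← h4, ← map_smul, ← hc, map_sub, P.d_d, sub_zero, sub_self]
  rw [hw, P.augmentation_d]

end IsSocleClass

/-- The natural injection of `Tor_2(k, M)` into `M`, whose image is the socle of `M`. -/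
theorem exists_socleMap (hxy : maximalIdeal A = Ideal.span {x, y}) (hreg : IsRegularPair x y)
    (hφ : ResidueField.map φ = RingHom.id (ResidueField A)) :
    ∃ η : ∀ M : ModuleCat.{u} (TwistedPolynomial φ), (torTwisted φ hφ 2).obj M →+ M,
      (∀ M, Function.Injective (η M)) ∧
      (∀ M s, s ∈ Set.range (η M) ↔ const φ x • s = 0 ∧ const φ y • s = 0) ∧
      ∀ (M N : ModuleCat.{u} (TwistedPolynomial φ)) (f : M ⟶ N) t,
        η N (((torTwisted φ hφ 2).map f).hom t) = f.hom (η M t) := by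
  choose η hη using fun (M : ModuleCat.{u} (TwistedPolynomial φ)) (t) ↦
    IsSocleClass.exists_socle (hφ := hφ) (P := projectiveResolution M) hxy hreg t
  have uniq {M : ModuleCat.{u} (TwistedPolynomial φ)} {t s s'}
      (h : IsSocleClass hφ x y (projectiveResolution M) t s)
      (h' : IsSocleClass hφ x y (projectiveResolution M) t s') : s = s' := by
    have := h.sub h'
    rw [sub_self] at this
    exact sub_eq_zero.mp (this.eq_zero_right hxy hreg)
  have hsub (M) (t t') : η M (t - t') = η M t - η M t' := uniq (hη M _) ((hη M t).sub (hη M t'))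
  refine ⟨fun M ↦ AddMonoidHom.ofMapSub (η M) (hsub M), fun M t t' h ↦ ?_, fun M s ↦ ⟨?_, ?_⟩,
    fun M N f t ↦ uniq (hη N _) ((hη M t).map f)⟩
  · have := (hη M t).sub (hη M t')
    rw [show η M t = η M t' from h, sub_self] at this
    exact sub_eq_zero.mp (this.eq_zero_left hxy)
  · rintro ⟨t, rfl⟩
    exact (hη M t).smul_eq_zero
  · rintro ⟨hx, hy⟩
    obtain ⟨t, ht⟩ := IsSocleClass.exists_class (hφ := hφ) (P := projectiveResolution M) hxy hx hy
    exact ⟨t, uniq (hη M t) ht⟩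

end Chase

/-! ### Additivity of left derived functors -/

instance CategoryTheory.Functor.additive_leftDerived {C D : Type*} [Category* C] [Category* D]
    [Abelian C] [HasProjectiveResolutions C] [Abelian D] (F : C ⥤ D) [F.Additive] (n : ℕ) :
    (F.leftDerived n).Additive where
  map_add {X Y f g} := by
    let P := projectiveResolution X
    let Q := projectiveResolution Y
    have h (f : X ⟶ Y) := F.leftDerived_map_eq n f (ProjectiveResolution.lift f P Q)
      (ProjectiveResolution.lift_commutes f P Q)
    rw [h f, h g, F.leftDerived_map_eq n (f + g) (P := P) (Q := Q)
      (ProjectiveResolution.lift f P Q + ProjectiveResolution.lift g P Q) (by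
        rw [Preadditive.add_comp, ProjectiveResolution.lift_commutes,
          ProjectiveResolution.lift_commutes, Functor.map_add, Preadditive.comp_add]),
      Functor.map_add, Preadditive.add_comp, Preadditive.comp_add]

/-! ### The Tor groups as functors on unbundled modules -/

section TorMap

variable {A : Type u} [CommRing A] [IsLocalRing A] {φ : A →+* A} [IsLocalHom φ]
  (hφ : ResidueField.map φ = RingHom.id (ResidueField A)) (n : ℕ)

/-- The group `Tor_n(k, M)` with its action of `k[X]`, for an unbundled module `M`. -/
abbrev TorModule (M : Type u) [AddCommGroup M] [Module (TwistedPolynomial φ) M] : Type u :=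
  (torTwisted φ hφ n).obj (ModuleCat.of (TwistedPolynomial φ) M)

variable {M N L : Type u} [AddCommGroup M] [Module (TwistedPolynomial φ) M] [AddCommGroup N]
  [Module (TwistedPolynomial φ) N] [AddCommGroup L] [Module (TwistedPolynomial φ) L]

/-- The map on `Tor_n(k, -)` induced by a linear map. -/
def torMap (f : M →ₗ[TwistedPolynomial φ] N) :
    TorModule hφ n M →ₗ[(ResidueField A)[X]] TorModule hφ n N :=
  ((torTwisted φ hφ n).map (ModuleCat.ofHom f)).hom

theorem torMap_id : torMap hφ n (LinearMap.id : M →ₗ[TwistedPolynomial φ] M) = LinearMap.id :=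
  congrArg ModuleCat.Hom.hom ((torTwisted φ hφ n).map_id (ModuleCat.of _ M))

theorem torMap_comp (g : N →ₗ[TwistedPolynomial φ] L) (f : M →ₗ[TwistedPolynomial φ] N) :
    torMap hφ n (g ∘ₗ f) = torMap hφ n g ∘ₗ torMap hφ n f :=
  congrArg ModuleCat.Hom.hom ((torTwisted φ hφ n).map_comp (ModuleCat.ofHom f) (ModuleCat.ofHom g))

theorem torMap_comp_apply (g : N →ₗ[TwistedPolynomial φ] L) (f : M →ₗ[TwistedPolynomial φ] N)
    (t : TorModule hφ n M) : torMap hφ n g (torMap hφ n f t) = torMap hφ n (g ∘ₗ f) t := by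
  rw [torMap_comp, LinearMap.comp_apply]

instance : (torTwisted φ hφ n).Additive :=
  inferInstanceAs ((twistedTensor φ hφ).leftDerived n).Additive

theorem torMap_add (f g : M →ₗ[TwistedPolynomial φ] N) :
    torMap hφ n (f + g) = torMap hφ n f + torMap hφ n g :=
  congrArg ModuleCat.Hom.hom ((torTwisted φ hφ n).map_add (f := ModuleCat.ofHom f)
    (g := ModuleCat.ofHom g))

theorem torMap_zero : torMap hφ n (0 : M →ₗ[TwistedPolynomial φ] N) = 0 := by
  have := torMap_add hφ n (0 : M →ₗ[TwistedPolynomial φ] N) 0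
  rwa [add_zero, left_eq_add] at this

theorem torMap_sum {ι : Type*} (s : Finset ι) (f : ι → M →ₗ[TwistedPolynomial φ] N) :
    torMap hφ n (∑ i ∈ s, f i) = ∑ i ∈ s, torMap hφ n (f i) :=
  map_sum (AddMonoidHom.mk' (torMap hφ n) (torMap_add hφ n)) f s

/-- `Tor_n(k, -)` commutes with finite powers. -/
def torPiEquiv {ι : Type} [Fintype ι] [DecidableEq ι] :
    TorModule hφ n (ι → M) ≃ₗ[(ResidueField A)[X]] (ι → TorModule hφ n M) where
  __ := LinearMap.pi fun i ↦ torMap hφ n (LinearMap.proj i : (ι → M) →ₗ[TwistedPolynomial φ] M)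
  invFun t := ∑ i, torMap hφ n (LinearMap.single (TwistedPolynomial φ) (fun _ : ι ↦ M) i) (t i)
  left_inv t := by
    change ∑ i, torMap hφ n _ (torMap hφ n _ t) = t
    simp only [torMap_comp_apply]
    rw [← LinearMap.sum_apply, ← torMap_sum]
    conv_rhs => rw [← LinearMap.id_apply (R := (ResidueField A)[X]) t, ← torMap_id]
    congr 2
    refine LinearMap.ext fun v ↦ ?_
    rw [LinearMap.sum_apply]
    exact Finset.univ_sum_single v
  right_inv t := by
    ext j
    change torMap hφ n _ (∑ i, torMap hφ n _ (t i)) = t j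
    rw [map_sum, Finset.sum_eq_single j]
    · rw [torMap_comp_apply, LinearMap.proj_comp_single_same, torMap_id, LinearMap.id_apply]
    · intro i _ hij
      rw [torMap_comp_apply, LinearMap.proj_comp_single_ne _ _ _ _ hij.symm, torMap_zero,
        LinearMap.zero_apply]
    · exact fun h ↦ absurd (Finset.mem_univ j) h

theorem torMap_apply_eq_sum {ι : Type} [Fintype ι] [DecidableEq ι]
    (f : (ι → M) →ₗ[TwistedPolynomial φ] N) (t : TorModule hφ n (ι → M)) :
    torMap hφ n f t = ∑ i, torMap hφ n (f ∘ₗ LinearMap.single (TwistedPolynomial φ) _ i)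
      (torPiEquiv hφ n t i) := by
  conv_lhs => rw [← (torPiEquiv hφ n).symm_apply_apply t]
  change torMap hφ n f (∑ i, torMap hφ n _ (torPiEquiv hφ n t i)) = _
  rw [map_sum]
  simp only [torMap_comp_apply]

/-- The long exact sequence of Tor groups. -/
theorem exists_tor_exact (f : M →ₗ[TwistedPolynomial φ] N) (g : N →ₗ[TwistedPolynomial φ] L)
    (hf : Function.Injective f) (hfg : Function.Exact f g) (hg : Function.Surjective g) :
    ∃ δ : ∀ n, TorModule hφ (n + 1) L →ₗ[(ResidueField A)[X]] TorModule hφ n M,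
      (∀ n, Function.Exact (torMap hφ n f) (torMap hφ n g)) ∧
      (∀ n, Function.Exact (torMap hφ (n + 1) g) (δ n)) ∧
      (∀ n, Function.Exact (δ n) (torMap hφ n f)) ∧ Function.Surjective (torMap hφ 0 g) := by
  let S : ShortComplex (ModuleCat.{u} (TwistedPolynomial φ)) :=
    ShortComplex.mk (ModuleCat.ofHom f) (ModuleCat.ofHom g)
      (ModuleCat.hom_ext (LinearMap.ext fun m ↦ hfg.apply_apply_eq_zero m))
  have hS : S.ShortExact :=
    { exact := (ShortComplex.ShortExact.moduleCat_exact_iff_function_exact S).mpr hfg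
      mono_f := (ModuleCat.mono_iff_injective _).mpr hf
      epi_g := (ModuleCat.epi_iff_surjective _).mpr hg }
  let P := SplitResolution.ofShortExact S hS
  have key {T : ShortComplex (ModuleCat.{u} (ResidueField A)[X])} (h : T.Exact) :
      Function.Exact T.f.hom T.g.hom :=
    (ShortComplex.ShortExact.moduleCat_exact_iff_function_exact T).mp h
  refine ⟨fun n ↦ (P.δ (twistedTensor φ hφ) n).hom, fun n ↦ ?_, fun n ↦ ?_, fun n ↦ ?_, ?_⟩
  · obtain ⟨w, h⟩ := SplitResolution.exact₂ (twistedTensor φ hφ) P n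
    exact key h
  · obtain ⟨w, h⟩ := P.exact₃ (twistedTensor φ hφ) n
    exact key h
  · obtain ⟨w, h⟩ := P.exact₁ (twistedTensor φ hφ) n
    exact key h
  · have h : Epi ((torTwisted φ hφ 0).map S.g) :=
      SplitResolution.epi_zero (twistedTensor φ hφ) P
    exact (ModuleCat.epi_iff_surjective ((torTwisted φ hφ 0).map S.g)).mp h

end TorMap

/-! ### Tor groups of free modules -/

section Free

open TwistedPolynomial

variable {A : Type u} [CommRing A] [IsLocalRing A] {φ : A →+* A} [IsLocalHom φ]
  (hφ : ResidueField.map φ = RingHom.id (ResidueField A))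
  (M : Type u) [AddCommGroup M] [Module (TwistedPolynomial φ) M]
  [Module.Projective (TwistedPolynomial φ) M]
  {N : Type u} [AddCommGroup N] [Module (TwistedPolynomial φ) N]
  [Module.Projective (TwistedPolynomial φ) N]

theorem subsingleton_tor_of_projective (n : ℕ) : Subsingleton (TorModule hφ (n + 1) M) := by
  have : Projective (ModuleCat.of (TwistedPolynomial φ) M) :=
    (IsProjective.iff_projective M).mp inferInstance
  exact ModuleCat.subsingleton_of_isZero
    ((twistedTensor φ hφ).isZero_leftDerived_obj_projective_succ n _)

/-- On projective modules, `Tor_0(k, -)` is `k ⊗ -`. -/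
def torZeroEquiv : TorModule hφ 0 M ≃ₗ[(ResidueField A)[X]]
    (twistedTensor φ hφ).obj (ModuleCat.of (TwistedPolynomial φ) M) :=
  have : Projective (ModuleCat.of (TwistedPolynomial φ) M) :=
    (IsProjective.iff_projective M).mp inferInstance
  (asIso ((twistedTensor φ hφ).fromLeftDerivedZero.app
    (ModuleCat.of (TwistedPolynomial φ) M))).toLinearEquiv

variable {M}

theorem torZeroEquiv_naturality (f : M →ₗ[TwistedPolynomial φ] N) (t : TorModule hφ 0 M) :
    torZeroEquiv hφ N (torMap hφ 0 f t) =
      ((twistedTensor φ hφ).map (ModuleCat.ofHom f)).hom (torZeroEquiv hφ M t) :=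
  ConcreteCategory.congr_hom
    ((twistedTensor φ hφ).fromLeftDerivedZero.naturality (ModuleCat.ofHom f)) t

variable (φ)

theorem exists_smul_tensorMk_one_eq
    (t : (twistedTensor φ hφ).obj (ModuleCat.of _ (TwistedPolynomial φ))) :
    ∃ f : (ResidueField A)[X], f • tensorMk φ hφ (ModuleCat.of _ (TwistedPolynomial φ)) 1 = t := by
  obtain ⟨r, rfl⟩ := tensorMk_surjective hφ _ t
  induction r using TwistedPolynomial.induction with
  | one => exact ⟨1, one_smul _ _⟩
  | add r s hr hs =>
    obtain ⟨f, hf⟩ := hr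
    obtain ⟨g, hg⟩ := hs
    exact ⟨f + g, by rw [add_smul, hf, hg, map_add]⟩
  | const_mul a r hr =>
    obtain ⟨f, hf⟩ := hr
    exact ⟨C (residue A a) * f, by
      rw [mul_smul, hf]
      exact (tensorMk_const_smul hφ
        (ModuleCat.of (TwistedPolynomial φ) (TwistedPolynomial φ)) a r).symm⟩
  | var_mul r hr =>
    obtain ⟨f, hf⟩ := hr
    exact ⟨X * f, by
      rw [mul_smul, hf]
      exact (tensorMk_var_smul hφ
        (ModuleCat.of (TwistedPolynomial φ) (TwistedPolynomial φ)) r).symm⟩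

theorem tensorMk_const_mul_var_pow (a : A) (n : ℕ) :
    tensorMk φ hφ (ModuleCat.of _ (TwistedPolynomial φ)) (const φ a * var φ ^ n) =
      (C (residue A a) * X ^ n : (ResidueField A)[X]) •
        tensorMk φ hφ (ModuleCat.of _ (TwistedPolynomial φ)) 1 := by
  rw [mul_smul]
  refine (tensorMk_const_smul hφ
    (ModuleCat.of (TwistedPolynomial φ) (TwistedPolynomial φ)) a _).trans ?_
  congr 1
  induction n with
  | zero => rw [pow_zero, pow_zero, one_smul]
  | succ n ih =>
    rw [pow_succ', pow_succ', mul_smul, ← ih]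
    exact tensorMk_var_smul hφ (ModuleCat.of (TwistedPolynomial φ) (TwistedPolynomial φ)) _

theorem eq_zero_of_smul_tensorMk_one {x y : A} (hxy : maximalIdeal A = Ideal.span {x, y})
    (f : (ResidueField A)[X])
    (hf : f • tensorMk φ hφ (ModuleCat.of _ (TwistedPolynomial φ)) 1 = 0) : f = 0 := by
  choose a ha using fun n ↦ residue_surjective (f.coeff n)
  have hr : tensorMk φ hφ (ModuleCat.of _ (TwistedPolynomial φ))
      (∑ i ∈ Finset.range (f.natDegree + 1), const φ (a i) * var φ ^ i) = 0 := by
    rw [← hf]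
    conv_rhs => rw [f.as_sum_range_C_mul_X_pow, Finset.sum_smul]
    refine (map_sum (tensorMk φ hφ (ModuleCat.of _ (TwistedPolynomial φ))) _ _).trans ?_
    refine Finset.sum_congr rfl fun i _ ↦ ?_
    rw [tensorMk_const_mul_var_pow, ha]
  obtain ⟨p, q, hpq⟩ := exists_of_tensorMk_eq_zero hφ hxy _ hr
  ext n
  by_cases hn : n < f.natDegree + 1
  · have h2 := congrArg (TwistedPolynomial.coeff (φ := φ) n) hpq
    rw [TwistedPolynomial.coeff_sum, if_pos hn] at h2
    have h3 : a n = x * TwistedPolynomial.coeff (φ := φ) n p +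
        y * TwistedPolynomial.coeff (φ := φ) n q := by
      rw [h2, map_add]
      exact congrArg₂ (· + ·) (coeff_const_mul x p n) (coeff_const_mul y q n)
    rw [← ha, coeff_zero, residue_eq_zero_iff, hxy, h3, mul_comm x, mul_comm y]
    exact Ideal.mem_span_pair.mpr ⟨_, _, rfl⟩
  · rw [coeff_zero]
    exact coeff_eq_zero_of_natDegree_lt (by lia)

/-- `Tor_0(k, A[X]_φ)` is free of rank one over `k[X]`. -/
theorem nonempty_torZero_linearEquiv {x y : A} (hxy : maximalIdeal A = Ideal.span {x, y}) :
    Nonempty (TorModule hφ 0 (TwistedPolynomial φ) ≃ₗ[(ResidueField A)[X]]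
      (ResidueField A)[X]) := by
  have e := LinearEquiv.ofBijective (LinearMap.toSpanSingleton (ResidueField A)[X] _
    (tensorMk φ hφ (ModuleCat.of _ (TwistedPolynomial φ)) 1))
    ⟨(injective_iff_map_eq_zero _).mpr fun f hf ↦ eq_zero_of_smul_tensorMk_one φ hφ hxy f hf,
      fun t ↦ exists_smul_tensorMk_one_eq φ hφ t⟩
  exact ⟨(torZeroEquiv hφ _).trans e.symm⟩

variable {φ}

theorem torMap_zero_eq_zero_of_tensorMk (f : TwistedPolynomial φ →ₗ[TwistedPolynomial φ] N)
    (hf : tensorMk φ hφ (ModuleCat.of _ N) (f 1) = 0) : torMap hφ 0 f = 0 := by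
  refine LinearMap.ext fun t ↦ (torZeroEquiv hφ N).injective ?_
  rw [torZeroEquiv_naturality, LinearMap.zero_apply, map_zero]
  obtain ⟨g, hg⟩ := exists_smul_tensorMk_one_eq φ hφ (torZeroEquiv hφ _ t)
  rw [← hg, map_smul, map_tensorMk]
  exact (congrArg (g • ·) hf).trans (smul_zero g)

end Free

/-! ### The module `A[X]_φ ⊗_A k` -/

namespace TwistedPolynomial

variable {A : Type u} [CommRing A] (φ : A →+* A) (x y : A)

/-- The map `(r, s) ↦ r x + s y` on the twisted polynomial ring. -/
def pairMap : (Fin 2 → TwistedPolynomial φ) →ₗ[TwistedPolynomial φ] TwistedPolynomial φ where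
  toFun v := v 0 * const φ x + v 1 * const φ y
  map_add' v w := by simp only [Pi.add_apply, add_mul]; abel
  map_smul' a v := by simp only [Pi.smul_apply, smul_eq_mul, mul_add, mul_assoc, RingHom.id_apply]

/-- The map `w ↦ (-w y, w x)`, the kernel of `pairMap` for a regular pair. -/
def koszulMap : TwistedPolynomial φ →ₗ[TwistedPolynomial φ] (Fin 2 → TwistedPolynomial φ) where
  toFun w := ![-(w * const φ y), w * const φ x]
  map_add' v w := by ext i; fin_cases i <;> simp [add_mul]; abel
  map_smul' a v := by ext i; fin_cases i <;> simp [mul_assoc]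

/-- The left module `A[X]_φ ⊗_A k`: the quotient of `A[X]_φ` by the left ideal generated by `x`
and `y`. -/
abbrev ResidueQuotient : Type u := TwistedPolynomial φ ⧸ LinearMap.range (pairMap φ x y)

/-- The class of `1`. -/
abbrev ResidueQuotient.one : ResidueQuotient φ x y := Submodule.Quotient.mk 1

variable {φ x y}

theorem koszulMap_injective (h : IsRegularPair x y) (hflat : φ.Flat) :
    Function.Injective (koszulMap φ x y) :=
  (injective_iff_map_eq_zero _).mpr fun w hw ↦
    eq_zero_of_mul_const h hflat w (congrFun hw 1)

theorem koszulMap_exact (h : IsRegularPair x y) (hflat : φ.Flat) :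
    Function.Exact (koszulMap φ x y) (pairMap φ x y).rangeRestrict := by
  intro v
  constructor
  · intro hv
    obtain ⟨w, h0, h1⟩ := exists_of_mul_const_add h hflat (v 0) (v 1) (congrArg Subtype.val hv)
    refine ⟨w, funext fun i ↦ ?_⟩
    fin_cases i
    · exact h0.symm
    · exact h1.symm
  · rintro ⟨w, rfl⟩
    refine Subtype.ext ?_
    change -(w * const φ y) * const φ x + w * const φ x * const φ y = 0
    rw [neg_mul, mul_assoc, mul_assoc, ← map_mul, ← map_mul, mul_comm x, neg_add_cancel]

namespace ResidueQuotient

theorem const_smul_one : const φ x • one φ x y = 0 ∧ const φ y • one φ x y = 0 := by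
  constructor
  · refine (Submodule.Quotient.mk_eq_zero _).mpr ⟨![1, 0], ?_⟩
    simp [pairMap]
  · refine (Submodule.Quotient.mk_eq_zero _).mpr ⟨![0, 1], ?_⟩
    simp [pairMap]

variable {M : Type*} [AddCommGroup M] [Module (TwistedPolynomial φ) M]

/-- An element of a module annihilated by `x` and `y` defines a map from `A[X]_φ ⊗_A k`. -/
def lift (s : M) (hx : const φ x • s = 0) (hy : const φ y • s = 0) :
    ResidueQuotient φ x y →ₗ[TwistedPolynomial φ] M :=
  Submodule.liftQ _ (LinearMap.toSpanSingleton _ M s) (by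
    rintro _ ⟨v, rfl⟩
    change (v 0 * const φ x + v 1 * const φ y) • s = 0
    rw [add_smul, mul_smul, mul_smul, hx, hy, smul_zero, smul_zero, add_zero])

theorem lift_one (s : M) (hx : const φ x • s = 0) (hy : const φ y • s = 0) :
    lift s hx hy (one φ x y) = s :=
  (Submodule.liftQ_apply _ _ _).trans (one_smul _ s)

end ResidueQuotient

end TwistedPolynomial

section TorResidueQuotient

open TwistedPolynomial

variable {A : Type u} [CommRing A] [IsLocalRing A] {φ : A →+* A} [IsLocalHom φ]
  (hφ : ResidueField.map φ = RingHom.id (ResidueField A)) {x y : A}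

theorem torMap_zero_eq_zero_of_eq_add (hxy : maximalIdeal A = Ideal.span {x, y}) {N : Type u}
    [AddCommGroup N] [Module (TwistedPolynomial φ) N] [Module.Projective (TwistedPolynomial φ) N]
    (f : TwistedPolynomial φ →ₗ[TwistedPolynomial φ] N) (p q : N)
    (hf : f 1 = const φ x • p + const φ y • q) : torMap hφ 0 f = 0 := by
  refine torMap_zero_eq_zero_of_tensorMk hφ f ?_
  have hx : x ∈ maximalIdeal A := hxy ▸ Ideal.subset_span (by simp)
  have hy : y ∈ maximalIdeal A := hxy ▸ Ideal.subset_span (by simp)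
  rw [hf]
  refine (map_add (tensorMk φ hφ (ModuleCat.of _ N)) _ _).trans ?_
  exact (congrArg₂ (· + ·) (tensorMk_const_smul_eq_zero hφ hx (ModuleCat.of _ N) p)
    (tensorMk_const_smul_eq_zero hφ hy (ModuleCat.of _ N) q)).trans (add_zero _)

theorem torMap_zero_pairMap (hxy : maximalIdeal A = Ideal.span {x, y}) :
    torMap hφ 0 (pairMap φ x y) = 0 := by
  refine LinearMap.ext fun t ↦ ?_
  rw [torMap_apply_eq_sum, Fin.sum_univ_two,
    torMap_zero_eq_zero_of_eq_add hφ hxy _ 1 0 (by simp [pairMap]),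
    torMap_zero_eq_zero_of_eq_add hφ hxy _ 0 1 (by simp [pairMap])]
  simp

theorem torMap_zero_koszulMap (hxy : maximalIdeal A = Ideal.span {x, y}) :
    torMap hφ 0 (koszulMap φ x y) = 0 := by
  refine torMap_zero_eq_zero_of_eq_add hφ hxy _ ![0, 1] ![-1, 0] ?_
  ext i
  fin_cases i <;> simp [koszulMap]

theorem bijective_of_exact {S M₁ M₂ M₃ M₄ : Type*} [Ring S] [AddCommGroup M₁] [AddCommGroup M₂]
    [AddCommGroup M₃] [AddCommGroup M₄] [Module S M₁] [Module S M₂] [Module S M₃] [Module S M₄]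
    {f : M₁ →ₗ[S] M₂} {g : M₂ →ₗ[S] M₃} {h : M₃ →ₗ[S] M₄} (hfg : Function.Exact f g)
    (hgh : Function.Exact g h) (hf : ∀ a, f a = 0) (hh : ∀ c, h c = 0) : Function.Bijective g := by
  refine ⟨(injective_iff_map_eq_zero g).mpr fun b hb ↦ ?_, fun c ↦ (hgh c).mp (hh c)⟩
  obtain ⟨a, rfl⟩ := (hfg b).mp hb
  exact hf a

/-- The groups `Tor_i(k, A[X]_φ ⊗_A k)`, computed by dimension shifting along the Koszul
resolution. -/
theorem tor_residueQuotient (hxy : maximalIdeal A = Ideal.span {x, y}) (hreg : IsRegularPair x y)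
    (hflat : φ.Flat) :
    Nonempty (TorModule hφ 2 (ResidueQuotient φ x y) ≃ₗ[(ResidueField A)[X]] (ResidueField A)[X]) ∧
    Nonempty (TorModule hφ 1 (ResidueQuotient φ x y) ≃ₗ[(ResidueField A)[X]]
      (Fin 2 → (ResidueField A)[X])) ∧
    ∃ f : (ResidueField A)[X] →ₗ[(ResidueField A)[X]] TorModule hφ 0 (ResidueQuotient φ x y),
      Function.Surjective f := by
  obtain ⟨e⟩ := nonempty_torZero_linearEquiv φ hφ hxy
  obtain ⟨δ, h1, h2, h3, h4⟩ := exists_tor_exact hφ (LinearMap.range (pairMap φ x y)).subtype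
    (LinearMap.range (pairMap φ x y)).mkQ (Submodule.subtype_injective _)
    (LinearMap.exact_subtype_mkQ _) (Submodule.mkQ_surjective _)
  obtain ⟨δ', h1', h2', h3', h4'⟩ := exists_tor_exact hφ (koszulMap φ x y)
    (pairMap φ x y).rangeRestrict (koszulMap_injective hreg hflat) (koszulMap_exact hreg hflat)
    (LinearMap.surjective_rangeRestrict _)
  have hR (n) := subsingleton_tor_of_projective hφ (TwistedPolynomial φ) n
  have hR2 (n) := subsingleton_tor_of_projective hφ (Fin 2 → TwistedPolynomial φ) n
  have hzero : ∀ t, torMap hφ 0 (LinearMap.range (pairMap φ x y)).subtype t = 0 := by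
    intro t
    obtain ⟨s, rfl⟩ := h4' t
    rw [torMap_comp_apply]
    exact LinearMap.congr_fun (torMap_zero_pairMap hφ hxy) s
  -- `δ` shifts from the quotient to the left ideal, `δ'` from the left ideal to the free module
  have b1 : Function.Bijective (δ 1) := bijective_of_exact (h2 1) (h3 1)
    (fun a ↦ by rw [(hR 1).elim a 0, map_zero]) (fun c ↦ (hR 0).elim _ _)
  have b0 : Function.Bijective (δ 0) := bijective_of_exact (h2 0) (h3 0)
    (fun a ↦ by rw [(hR 0).elim a 0, map_zero]) hzero
  have b0' : Function.Bijective (δ' 0) := bijective_of_exact (h2' 0) (h3' 0)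
    (fun a ↦ by rw [(hR2 0).elim a 0, map_zero])
    (fun c ↦ LinearMap.congr_fun (torMap_zero_koszulMap hφ hxy) c)
  have b4' : Function.Bijective (torMap hφ 0 (pairMap φ x y).rangeRestrict) :=
    ⟨(injective_iff_map_eq_zero _).mpr fun b hb ↦ by
      obtain ⟨a, rfl⟩ := (h1' 0 b).mp hb
      exact LinearMap.congr_fun (torMap_zero_koszulMap hφ hxy) a, h4'⟩
  refine ⟨⟨(LinearEquiv.ofBijective _ b1).trans ((LinearEquiv.ofBijective _ b0').trans e)⟩,
    ⟨(LinearEquiv.ofBijective _ b0).trans ((LinearEquiv.ofBijective _ b4').symm.trans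
      ((torPiEquiv hφ 0).trans (LinearEquiv.piCongrRight fun _ ↦ e)))⟩,
    torMap hφ 0 (LinearMap.range (pairMap φ x y)).mkQ ∘ₗ e.symm.toLinearMap,
    h4.comp e.symm.surjective⟩

end TorResidueQuotient

/-! ### The socle map -/

section Socle

open TwistedPolynomial

variable {A : Type u} [CommRing A] [IsLocalRing A] {φ : A →+* A} [IsLocalHom φ]
  (hφ : ResidueField.map φ = RingHom.id (ResidueField A))

/-- A natural bijection of `Tor_2(k, M)` with the socle of `M`, for all modules `M`. -/
structure SocleMap (x y : A) where
  /-- The embedding of `Tor_2(k, M)` in `M`. -/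
  toFun (M : Type u) [AddCommGroup M] [Module (TwistedPolynomial φ) M] : TorModule hφ 2 M →+ M
  injective (M : Type u) [AddCommGroup M] [Module (TwistedPolynomial φ) M] :
    Function.Injective (toFun M)
  const_smul {M : Type u} [AddCommGroup M] [Module (TwistedPolynomial φ) M] (t : TorModule hφ 2 M) :
    const φ x • toFun M t = 0 ∧ const φ y • toFun M t = 0
  exists_eq {M : Type u} [AddCommGroup M] [Module (TwistedPolynomial φ) M] (s : M)
    (hx : const φ x • s = 0) (hy : const φ y • s = 0) : ∃ t, toFun M t = s
  naturality {M N : Type u} [AddCommGroup M] [Module (TwistedPolynomial φ) M]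
    [AddCommGroup N] [Module (TwistedPolynomial φ) N] (f : M →ₗ[TwistedPolynomial φ] N)
    (t : TorModule hφ 2 M) : toFun N (torMap hφ 2 f t) = f (toFun M t)

variable {x y : A}

theorem nonempty_socleMap (hxy : maximalIdeal A = Ideal.span {x, y}) (hreg : IsRegularPair x y) :
    Nonempty (SocleMap hφ x y) := by
  obtain ⟨η, h1, h2, h3⟩ := exists_socleMap hxy hreg hφ
  exact ⟨{
    toFun := fun M _ _ ↦ η (ModuleCat.of _ M)
    injective := fun M _ _ ↦ h1 (ModuleCat.of _ M)
    const_smul := fun {M _ _} t ↦ (h2 (ModuleCat.of _ M) _).mp ⟨t, rfl⟩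
    exists_eq := fun {M _ _} s hx hy ↦ (h2 (ModuleCat.of _ M) s).mpr ⟨hx, hy⟩
    naturality := fun {M N _ _ _ _} f t ↦ h3 _ _ (ModuleCat.ofHom f) t }⟩

variable {hφ}

/-- The class in `Tor_2` that corresponds to the generator of `A[X]_φ ⊗_A k` under the socle map is
a basis: if `u'` is any basis and `u` that class, the endomorphism of `A[X]_φ ⊗_A k` which
sends the generator to the socle element of `u'` induces on `Tor_2` a map with `u ↦ u'`. -/
theorem SocleMap.exists_basis (η : SocleMap hφ x y) (hxy : maximalIdeal A = Ideal.span {x, y})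
    (hreg : IsRegularPair x y) (hflat : φ.Flat) :
    ∃ e : TorModule hφ 2 (ResidueQuotient φ x y) ≃ₗ[(ResidueField A)[X]] (ResidueField A)[X],
      η.toFun _ (e.symm 1) = ResidueQuotient.one φ x y := by
  obtain ⟨⟨e⟩, -, -⟩ := tor_residueQuotient hφ hxy hreg hflat
  obtain ⟨u, hu⟩ := η.exists_eq (ResidueQuotient.one φ x y) ResidueQuotient.const_smul_one.1
    ResidueQuotient.const_smul_one.2
  let v := ResidueQuotient.lift (η.toFun _ (e.symm 1)) (η.const_smul _).1 (η.const_smul _).2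
  have hv : torMap hφ 2 v u = e.symm 1 := by
    refine η.injective _ ?_
    rw [η.naturality, hu]
    exact ResidueQuotient.lift_one _ _ _
  have hlin (t) : t = e t • e.symm 1 := by
    rw [← map_smul, smul_eq_mul, mul_one, e.symm_apply_apply]
  have hmul : e u * e (torMap hφ 2 v (e.symm 1)) = 1 := by
    have h := congrArg e hv
    rwa [hlin u, map_smul, map_smul, e.apply_symm_apply, smul_eq_mul] at h
  let unit : (ResidueField A)[X]ˣ := Units.mkOfMulEqOne _ _ hmul
  refine ⟨e.trans (LinearEquiv.smulOfUnit unit⁻¹), ?_⟩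
  rw [← hu]
  congr 1
  refine (LinearEquiv.symm_apply_eq _).mpr ?_
  exact (unit.inv_mul).symm

end Socle

/-! ### Modules over a polynomial ring in one variable -/

section PolynomialModule

/-- A finitely generated torsion module over `k[X]` has finite dimension over `k`. -/
theorem finite_of_isTorsion {K V : Type*} [Field K] [AddCommGroup V] [Module K[X] V] [Module K V]
    [IsScalarTower K K[X] V] [Module.Finite K[X] V] (hV : Module.IsTorsion K[X] V) :
    Module.Finite K V := by
  obtain ⟨n, v, hv⟩ := Module.Finite.exists_fin (R := K[X]) (M := V)
  choose f hf using fun i ↦ hV (x := v i)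
  -- a generator killed by `f i` only needs coefficients of degree less than the degree of `f i`
  let L : (∀ i : Fin n, degreeLT K (f i : K[X]).natDegree) →ₗ[K] V :=
    { toFun := fun g ↦ ∑ i, (g i : K[X]) • v i
      map_add' := fun g h ↦ by
        simp only [Pi.add_apply, Submodule.coe_add, add_smul, Finset.sum_add_distrib]
      map_smul' := fun c g ↦ by
        simp only [Pi.smul_apply, Submodule.coe_smul, smul_assoc, Finset.smul_sum,
          RingHom.id_apply] }
  have (d : ℕ) : Module.Finite K (degreeLT K d) :=
    Module.Finite.equiv (degreeLTEquiv K d).symm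
  refine Module.Finite.of_surjective L fun w ↦ ?_
  obtain ⟨p, rfl⟩ := (Submodule.mem_span_range_iff_exists_fun K[X]).mp
    (hv ▸ Submodule.mem_top : w ∈ Submodule.span K[X] (Set.range v))
  have hmem (i : Fin n) : p i % (f i : K[X]) ∈ degreeLT K (f i : K[X]).natDegree := by
    have h0 : (f i : K[X]) ≠ 0 := nonZeroDivisors.coe_ne_zero (f i)
    rw [mem_degreeLT, ← degree_eq_natDegree h0]
    exact EuclideanDomain.mod_lt _ h0
  refine ⟨fun i ↦ ⟨_, hmem i⟩, ?_⟩
  change ∑ i, (p i % (f i : K[X])) • v i = _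
  refine Finset.sum_congr rfl fun i _ ↦ ?_
  have h : (f i : K[X]) • v i = 0 := hf i
  conv_rhs => rw [← EuclideanDomain.mod_add_div (p i) (f i), add_smul, mul_comm, mul_smul, h,
    smul_zero, add_zero]

theorem finrank_range_add_finrank_ker_of_isDomain {S V W : Type*} [CommRing S] [IsDomain S]
    [AddCommGroup V] [Module S V] [AddCommGroup W] [Module S W] [Module.Finite S V]
    (f : V →ₗ[S] W) :
    Module.finrank S (LinearMap.range f) + Module.finrank S (LinearMap.ker f) =
      Module.finrank S V := by
  rw [← f.quotKerEquivRange.finrank_eq]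
  exact Submodule.finrank_quotient_add_finrank _

/-- A finitely generated module over a principal ideal domain contains a free submodule which
is a complement of the torsion. -/
theorem exists_complement_torsion {S V : Type*} [CommRing S] [IsDomain S] [IsPrincipalIdealRing S]
    [AddCommGroup V] [Module S V] [Module.Finite S V] :
    ∃ t : Fin (Module.finrank S V) → V,
      (∀ c : Fin (Module.finrank S V) → S,
        ∑ j, c j • t j ∈ Submodule.torsion S V → c = 0) ∧
      ∀ v, ∃ c : Fin (Module.finrank S V) → S, v - ∑ j, c j • t j ∈ Submodule.torsion S V := by
  have h : Module.finrank S (V ⧸ Submodule.torsion S V) = Module.finrank S V :=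
    finrank_quotient_eq_of_le_torsion le_rfl
  have : Module.Free S (V ⧸ Submodule.torsion S V) := inferInstance
  let b := (Module.finBasis S (V ⧸ Submodule.torsion S V)).reindex (finCongr h)
  choose t ht using fun j ↦ Submodule.mkQ_surjective (Submodule.torsion S V) (b j)
  refine ⟨t, fun c hc ↦ ?_, fun v ↦ ⟨b.repr ((Submodule.torsion S V).mkQ v), ?_⟩⟩
  · rw [← Submodule.Quotient.mk_eq_zero, ← Submodule.mkQ_apply, map_sum] at hc
    simp only [map_smul, ht] at hc
    exact funext (Fintype.linearIndependent_iff.mp b.linearIndependent c hc)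
  · rw [← Submodule.Quotient.mk_eq_zero, ← Submodule.mkQ_apply, map_sub, map_sum]
    simp only [map_smul, ht, b.sum_repr, sub_self]

end PolynomialModule

/-! ### Finiteness of the Tor groups of finitely presented modules -/

section Finite

open TwistedPolynomial

variable {A : Type u} [CommRing A] [IsLocalRing A] {φ : A →+* A} [IsLocalHom φ]
  (hφ : ResidueField.map φ = RingHom.id (ResidueField A)) {x y : A}

theorem finite_tor_zero (hxy : maximalIdeal A = Ideal.span {x, y})
    (M : Type u) [AddCommGroup M] [Module (TwistedPolynomial φ) M]
    [Module.Finite (TwistedPolynomial φ) M] :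
    Module.Finite (ResidueField A)[X] (TorModule hφ 0 M) := by
  obtain ⟨n, f, hf⟩ := Module.Finite.exists_fin' (TwistedPolynomial φ) M
  obtain ⟨e⟩ := nonempty_torZero_linearEquiv φ hφ hxy
  obtain ⟨-, -, -, -, h⟩ := exists_tor_exact hφ (LinearMap.ker f).subtype f
    (Submodule.subtype_injective _) (LinearMap.exact_subtype_ker_map f) hf
  have : Module.Finite (ResidueField A)[X] (TorModule hφ 0 (TwistedPolynomial φ)) :=
    Module.Finite.equiv e.symm
  have : Module.Finite (ResidueField A)[X] (TorModule hφ 0 (Fin n → TwistedPolynomial φ)) :=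
    Module.Finite.equiv (torPiEquiv hφ 0).symm
  exact Module.Finite.of_surjective _ h

/-- Dimension shifting. -/
theorem tor_injective_of_projective {M N L : Type u} [AddCommGroup M]
    [Module (TwistedPolynomial φ) M] [AddCommGroup N] [Module (TwistedPolynomial φ) N]
    [AddCommGroup L] [Module (TwistedPolynomial φ) L] [Module.Projective (TwistedPolynomial φ) N]
    (f : M →ₗ[TwistedPolynomial φ] N) (g : N →ₗ[TwistedPolynomial φ] L)
    (hf : Function.Injective f) (hfg : Function.Exact f g) (hg : Function.Surjective g) (n : ℕ) :
    ∃ δ : TorModule hφ (n + 1) L →ₗ[(ResidueField A)[X]] TorModule hφ n M,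
      Function.Injective δ := by
  obtain ⟨δ, -, h, -, -⟩ := exists_tor_exact hφ f g hf hfg hg
  refine ⟨δ n, (injective_iff_map_eq_zero _).mpr fun t ht ↦ ?_⟩
  obtain ⟨s, rfl⟩ := (h n t).mp ht
  rw [(subsingleton_tor_of_projective hφ N n).elim s 0, map_zero]

/-- By coherence the Tor groups of a finitely presented module are finitely generated: dimension
shifting embeds them in groups `Tor_0` of finitely presented modules. -/
theorem finite_tor_of_finitePresentation [IsNoetherianRing A]
    (hxy : maximalIdeal A = Ideal.span {x, y}) (hflat : φ.Flat) (n : ℕ) (M : Type u)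
    [AddCommGroup M] [Module (TwistedPolynomial φ) M]
    [Module.FinitePresentation (TwistedPolynomial φ) M] :
    Module.Finite (ResidueField A)[X] (TorModule hφ n M) := by
  induction n generalizing M with
  | zero => exact finite_tor_zero hφ hxy M
  | succ n ih =>
    obtain ⟨m, f, hf⟩ := Module.Finite.exists_fin' (TwistedPolynomial φ) M
    have := finitePresentation_of_fg hflat (LinearMap.ker f)
      (Module.FinitePresentation.fg_ker f hf)
    have := ih (LinearMap.ker f)
    obtain ⟨δ, hδ⟩ := tor_injective_of_projective hφ (LinearMap.ker f).subtype f
      (Submodule.subtype_injective _) (LinearMap.exact_subtype_ker_map f) hf n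
    exact Module.Finite.of_injective δ hδ

theorem torRank_eq_finrank (i : ℕ) (M : ModuleCat.{u} (TwistedPolynomial φ)) :
    torRank φ hφ i M = Module.finrank (ResidueField A)[X] ((torTwisted φ hφ i).obj M) :=
  (TensorProduct.isBaseChange (ResidueField A)[X] ((torTwisted φ hφ i).obj M)
    (RatFunc (ResidueField A))).finrank_eq

theorem isAdmissible_of_isTorsion {M : ModuleCat.{u} (TwistedPolynomial φ)}
    (h : IsLocallyArtinian A ((underlying φ).obj M))
    [Module.Finite (ResidueField A)[X] ((torTwisted φ hφ 2).obj M)]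
    (htors : Module.IsTorsion (ResidueField A)[X] ((torTwisted φ hφ 2).obj M)) :
    IsAdmissible A 2 ((underlying φ).obj M) := by
  refine ⟨h, ?_⟩
  let := Module.compHom ((torTwisted φ hφ 2).obj M) (C : ResidueField A →+* (ResidueField A)[X])
  have : IsScalarTower (ResidueField A) (ResidueField A)[X] ((torTwisted φ hφ 2).obj M) :=
    ⟨fun c f t ↦ by rw [smul_eq_C_mul]; exact mul_smul (C c) f t⟩
  have hfin : Module.Finite (ResidueField A) ((torTwisted φ hφ 2).obj M) :=
    finite_of_isTorsion htors
  have hfin' : Module.Finite (ResidueField A)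
      ((ModuleCat.restrictScalars (C : ResidueField A →+* (ResidueField A)[X])).obj
        ((torTwisted φ hφ 2).obj M)) := hfin
  exact Module.Finite.equiv (torTwistedIso φ hφ 2 M).toLinearEquiv

/-- If `χ(M) = 0` and `h_0(M) = 0`, then `h_1(M) = h_2(M)`. -/
theorem torRank_one_eq_torRank_two (hxy : maximalIdeal A = Ideal.span {x, y})
    (hreg : IsRegularPair x y) (M : ModuleCat.{u} (TwistedPolynomial φ))
    (hχ : eulerChar φ hφ M = 0) (h0 : torRank φ hφ 0 M = 0) :
    torRank φ hφ 1 M = torRank φ hφ 2 M := by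
  have h3 (n : ℕ) : torRank φ hφ (n + 3) M = 0 := by
    have : Subsingleton ((torTwisted φ hφ (n + 3)).obj M) :=
      ⟨fun s t ↦ by rw [torTwisted_eq_zero hxy hreg M n s, torTwisted_eq_zero hxy hreg M n t]⟩
    rw [torRank_eq_finrank]
    exact Module.finrank_zero_of_subsingleton
  rw [eulerChar, finsum_eq_sum_of_support_subset (s := Finset.range 3)] at hχ
  · simp only [Finset.sum_range_succ, Finset.sum_range_zero, h0] at hχ
    lia
  · intro i hi
    by_contra h
    obtain ⟨n, rfl⟩ : ∃ n, i = n + 3 := ⟨i - 3, by simp at h; lia⟩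
    simp [h3] at hi

end Finite

/-! ### Modules with enough socle -/

section PowerTorsion

open TwistedPolynomial

variable {A : Type u} [CommRing A] [IsLocalRing A] {φ : A →+* A} {x y : A}

/-- Every element of the module is annihilated by a power of the maximal ideal. -/
def IsMaxPowerTorsion (φ : A →+* A) (N : Type*) [AddCommGroup N] [Module (TwistedPolynomial φ) N] :
    Prop :=
  ∀ v : N, ∃ n, ∀ a ∈ maximalIdeal A ^ n, const φ a • v = 0

theorem IsMaxPowerTorsion.pi {ι N : Type*} [Finite ι] [AddCommGroup N]
    [Module (TwistedPolynomial φ) N] (h : IsMaxPowerTorsion φ N) :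
    IsMaxPowerTorsion φ (ι → N) := by
  intro v
  choose n hn using fun i ↦ h (v i)
  obtain ⟨d, hd⟩ := (Set.finite_range n).bddAbove
  exact ⟨d, fun a ha ↦ funext fun i ↦ hn i a (Ideal.pow_le_pow_right (hd ⟨i, rfl⟩) ha)⟩

/-- As `φ` generates an ideal containing a power of the maximal ideal, passing from `r` to `X r`
preserves being annihilated by a power of the maximal ideal. -/
theorem ResidueQuotient.isMaxPowerTorsion (hxy : maximalIdeal A = Ideal.span {x, y})
    (hrad : ∃ k, maximalIdeal A ^ k ≤ (maximalIdeal A).map φ) :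
    IsMaxPowerTorsion φ (ResidueQuotient φ x y) := by
  intro v
  obtain ⟨r, rfl⟩ := Submodule.Quotient.mk_surjective _ v
  induction r using TwistedPolynomial.induction with
  | one =>
    refine ⟨1, fun a ha ↦ ?_⟩
    rw [pow_one, hxy] at ha
    obtain ⟨b, c, rfl⟩ := Ideal.mem_span_pair.mp ha
    have h := ResidueQuotient.const_smul_one (φ := φ) (x := x) (y := y)
    rw [map_add, map_mul, map_mul, add_smul, mul_smul, mul_smul, h.1, h.2, smul_zero, smul_zero,
      add_zero]
  | add r s hr hs =>
    obtain ⟨n, hn⟩ := hr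
    obtain ⟨m, hm⟩ := hs
    refine ⟨max n m, fun a ha ↦ ?_⟩
    rw [Submodule.Quotient.mk_add, smul_add, hn a (Ideal.pow_le_pow_right (le_max_left _ _) ha),
      hm a (Ideal.pow_le_pow_right (le_max_right _ _) ha), add_zero]
  | const_mul b r hr =>
    obtain ⟨n, hn⟩ := hr
    refine ⟨n, fun a ha ↦ ?_⟩
    rw [← smul_eq_mul, Submodule.Quotient.mk_smul, const_smul_comm, hn a ha, smul_zero]
  | var_mul r hr =>
    obtain ⟨n, hn⟩ := hr
    obtain ⟨k, hk⟩ := hrad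
    refine ⟨k * n, fun a ha ↦ ?_⟩
    have ha' : a ∈ (maximalIdeal A ^ n).map φ := by
      rw [Ideal.map_pow]
      rw [pow_mul] at ha
      exact Ideal.pow_right_mono hk n ha
    rw [← smul_eq_mul, Submodule.Quotient.mk_smul]
    rw [Ideal.map] at ha'
    clear ha
    induction ha' using Submodule.span_induction with
    | mem a ha =>
      obtain ⟨b, hb, rfl⟩ := ha
      rw [smul_smul, ← var_mul_const, mul_smul, hn b hb, smul_zero]
    | zero => rw [map_zero, zero_smul]
    | add a b _ _ ha hb => rw [map_add, add_smul, ha, hb, add_zero]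
    | smul c a _ ha => rw [smul_eq_mul, map_mul, mul_smul, ha, smul_zero]

theorem IsMaxPowerTorsion.exists_socle_ne_zero (hxy : maximalIdeal A = Ideal.span {x, y})
    {N : Type*} [AddCommGroup N] [Module (TwistedPolynomial φ) N] (h : IsMaxPowerTorsion φ N)
    {v : N} (hv : v ≠ 0) :
    ∃ a, const φ a • v ≠ 0 ∧ const φ x • const φ a • v = 0 ∧ const φ y • const φ a • v = 0 := by
  classical
  have hx : x ∈ maximalIdeal A := hxy ▸ Ideal.subset_span (by simp)
  have hy : y ∈ maximalIdeal A := hxy ▸ Ideal.subset_span (by simp)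
  -- the last nonzero power of the maximal ideal applied to `v` lies in the socle
  set n := Nat.find (h v) with hn
  have hspec := Nat.find_spec (h v)
  rw [← hn] at hspec
  have hpos : n ≠ 0 := fun h0 ↦ hv <| by
    have := hspec 1 (by rw [h0, pow_zero, Ideal.one_eq_top]; exact Submodule.mem_top)
    rwa [map_one, one_smul] at this
  obtain ⟨m, hm⟩ := Nat.exists_eq_succ_of_ne_zero hpos
  have hmin := Nat.find_min (h v) (m := m) (by rw [← hn]; lia)
  push Not at hmin
  obtain ⟨a, ha, hav⟩ := hmin
  refine ⟨a, hav, ?_, ?_⟩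
  · rw [smul_smul, ← map_mul]
    exact hspec _ (by rw [hm, pow_succ']; exact Ideal.mul_mem_mul hx ha)
  · rw [smul_smul, ← map_mul]
    exact hspec _ (by rw [hm, pow_succ']; exact Ideal.mul_mem_mul hy ha)

/-- A map that is injective on `Tor_2(k, -)`, hence on socles, is injective on a module all of whose
nonzero submodules meet the socle. -/
theorem SocleMap.injective_of_torMap_injective [IsLocalHom φ]
    {hφ : ResidueField.map φ = RingHom.id (ResidueField A)}
    (η : SocleMap hφ x y) (hxy : maximalIdeal A = Ideal.span {x, y})
    {N M : Type u} [AddCommGroup N] [Module (TwistedPolynomial φ) N] [AddCommGroup M]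
    [Module (TwistedPolynomial φ) M] (h : IsMaxPowerTorsion φ N)
    (g : N →ₗ[TwistedPolynomial φ] M) (hg : Function.Injective (torMap hφ 2 g)) :
    Function.Injective g := by
  refine (injective_iff_map_eq_zero g).mpr fun v hv ↦ ?_
  by_contra hv0
  obtain ⟨a, ha, hx, hy⟩ := h.exists_socle_ne_zero hxy hv0
  obtain ⟨t, ht⟩ := η.exists_eq _ hx hy
  refine ha ?_
  have : torMap hφ 2 g t = 0 := by
    refine η.injective _ ?_
    rw [η.naturality, ht, map_smul, hv, smul_zero, map_zero]
  rw [← ht, (injective_iff_map_eq_zero _).mp hg t this, map_zero]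

end PowerTorsion

/-! ### Splitting off the free part of the second Tor group -/

section Step

open TwistedPolynomial

variable {A : Type u} [CommRing A] [IsLocalRing A] {φ : A →+* A} [IsLocalHom φ]
  {hφ : ResidueField.map φ = RingHom.id (ResidueField A)} {x y : A}

/-- A free submodule of `Tor_2(k, M)` with basis `t j` is the image of `Tor_2` under an embedding
of copies of `A[X]_φ ⊗_A k` in `M`. -/
theorem SocleMap.exists_embedding (η : SocleMap hφ x y)
    (hxy : maximalIdeal A = Ideal.span {x, y}) (hreg : IsRegularPair x y) (hflat : φ.Flat)
    (hrad : ∃ k, maximalIdeal A ^ k ≤ (maximalIdeal A).map φ)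
    {M : Type u} [AddCommGroup M] [Module (TwistedPolynomial φ) M] {r : ℕ}
    (t : Fin r → TorModule hφ 2 M)
    (ht : ∀ c : Fin r → (ResidueField A)[X], ∑ j, c j • t j = 0 → c = 0) :
    ∃ g : (Fin r → ResidueQuotient φ x y) →ₗ[TwistedPolynomial φ] M, Function.Injective g ∧
      Function.Injective (torMap hφ 2 g) ∧
      ∀ s, s ∈ LinearMap.range (torMap hφ 2 g) ↔ ∃ c : Fin r → (ResidueField A)[X],
        s = ∑ j, c j • t j := by
  obtain ⟨e, he⟩ := η.exists_basis hxy hreg hflat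
  let gj (j : Fin r) : ResidueQuotient φ x y →ₗ[TwistedPolynomial φ] M :=
    ResidueQuotient.lift (η.toFun M (t j)) (η.const_smul (t j)).1 (η.const_smul (t j)).2
  have hgj (j : Fin r) : torMap hφ 2 (gj j) (e.symm 1) = t j := by
    refine η.injective _ ?_
    rw [η.naturality, he]
    exact ResidueQuotient.lift_one _ _ _
  let g : (Fin r → ResidueQuotient φ x y) →ₗ[TwistedPolynomial φ] M :=
    ∑ j, gj j ∘ₗ LinearMap.proj j
  let E := (torPiEquiv hφ 2 (M := ResidueQuotient φ x y) (ι := Fin r)).trans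
    (LinearEquiv.piCongrRight fun _ ↦ e)
  have hg (s) : torMap hφ 2 g s = ∑ j, E s j • t j := by
    rw [torMap_sum, LinearMap.sum_apply]
    refine Finset.sum_congr rfl fun j _ ↦ ?_
    have h : torMap hφ 2 (LinearMap.proj j) s = E s j • e.symm 1 := by
      rw [← map_smul, smul_eq_mul, mul_one]
      exact (e.symm_apply_apply _).symm
    rw [← hgj, ← map_smul, ← h, torMap_comp_apply]
  have hinj : Function.Injective (torMap hφ 2 g) :=
    (injective_iff_map_eq_zero _).mpr fun s hs ↦ by
      rw [hg] at hs
      exact E.map_eq_zero_iff.mp (ht _ hs)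
  refine ⟨g, η.injective_of_torMap_injective hxy
    (ResidueQuotient.isMaxPowerTorsion hxy hrad).pi g hinj, hinj, fun s ↦ ⟨?_, ?_⟩⟩
  · rintro ⟨s, rfl⟩
    exact ⟨_, hg s⟩
  · rintro ⟨c, rfl⟩
    exact ⟨E.symm c, by rw [hg, E.apply_symm_apply]⟩

/-- One step of the construction: if `h_1(M) ≤ h_2(M)` and `h_2(M) > 0`, then a free complement of
the torsion in `Tor_2(k, M)` is realised by a submodule `K` of `M` such that the maps between the
torsion submodules and the inequalities pass to `M ⧸ K`. -/
theorem SocleMap.exists_submodule [IsNoetherianRing A] (η : SocleMap hφ x y)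
    (hxy : maximalIdeal A = Ideal.span {x, y}) (hreg : IsRegularPair x y) (hflat : φ.Flat)
    (hrad : ∃ k, maximalIdeal A ^ k ≤ (maximalIdeal A).map φ)
    (M : Type u) [AddCommGroup M] [Module (TwistedPolynomial φ) M]
    [Module.FinitePresentation (TwistedPolynomial φ) M]
    (h12 : Module.finrank (ResidueField A)[X] (TorModule hφ 1 M) ≤
      Module.finrank (ResidueField A)[X] (TorModule hφ 2 M))
    (h2 : 0 < Module.finrank (ResidueField A)[X] (TorModule hφ 2 M)) :
    ∃ K : Submodule (TwistedPolynomial φ) M, K ≠ ⊥ ∧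
      Module.FinitePresentation (TwistedPolynomial φ) (M ⧸ K) ∧
      Module.finrank (ResidueField A)[X] (TorModule hφ 1 (M ⧸ K)) ≤
        Module.finrank (ResidueField A)[X] (TorModule hφ 2 (M ⧸ K)) ∧
      0 < Module.finrank (ResidueField A)[X] (TorModule hφ 2 (M ⧸ K)) ∧
      (∀ t ∈ Submodule.torsion (ResidueField A)[X] (TorModule hφ 2 M),
        torMap hφ 2 K.mkQ t = 0 → t = 0) ∧
      (∀ t, ∃ t₀ ∈ Submodule.torsion (ResidueField A)[X] (TorModule hφ 2 M),
        torMap hφ 2 K.mkQ t = torMap hφ 2 K.mkQ t₀) ∧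
      ∀ t ∈ Submodule.torsion (ResidueField A)[X] (TorModule hφ 2 (M ⧸ K)),
        ∃ t₀ ∈ Submodule.torsion (ResidueField A)[X] (TorModule hφ 2 M),
          torMap hφ 2 K.mkQ t₀ = t := by
  have fin (i) := finite_tor_of_finitePresentation hφ hxy hflat i M
  have := fin 1
  have := fin 2
  obtain ⟨r, hr, t, ht0, htspan⟩ : ∃ r, r = Module.finrank (ResidueField A)[X] (TorModule hφ 2 M) ∧
      ∃ t : Fin r → TorModule hφ 2 M,
        (∀ c : Fin r → (ResidueField A)[X],
          ∑ j, c j • t j ∈ Submodule.torsion (ResidueField A)[X] (TorModule hφ 2 M) → c = 0) ∧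
        ∀ v, ∃ c : Fin r → (ResidueField A)[X],
          v - ∑ j, c j • t j ∈ Submodule.torsion (ResidueField A)[X] (TorModule hφ 2 M) :=
    ⟨_, rfl, exists_complement_torsion⟩
  have hlin (c : Fin r → (ResidueField A)[X]) (hc : ∑ j, c j • t j = 0) : c = 0 :=
    ht0 c (hc ▸ Submodule.zero_mem _)
  obtain ⟨g, hg, hTg, hrange⟩ := η.exists_embedding hxy hreg hflat hrad t hlin
  obtain ⟨-, ⟨e1⟩, f0, hf0⟩ := tor_residueQuotient hφ hxy hreg hflat
  obtain ⟨δ, ex2, ex3, ex1, -⟩ := exists_tor_exact hφ g (LinearMap.range g).mkQ hg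
    (LinearMap.exact_map_mkQ_range g) (Submodule.mkQ_surjective _)
  let E1 := (torPiEquiv hφ 1 (M := ResidueQuotient φ x y) (ι := Fin r)).trans
    (LinearEquiv.piCongrRight fun _ ↦ e1)
  have fpQ : Module.FinitePresentation (TwistedPolynomial φ) (M ⧸ LinearMap.range g) := by
    refine Module.finitePresentation_of_surjective (LinearMap.range g).mkQ
      (Submodule.mkQ_surjective _) ?_
    rw [Submodule.ker_mkQ, LinearMap.range_eq_map]
    exact (Module.Finite.fg_top).map g
  have := finite_tor_of_finitePresentation hφ hxy hflat 1 (M ⧸ LinearMap.range g)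
  have := finite_tor_of_finitePresentation hφ hxy hflat 2 (M ⧸ LinearMap.range g)
  have : Module.Finite (ResidueField A)[X] (TorModule hφ 1 (Fin r → ResidueQuotient φ x y)) :=
    Module.Finite.equiv E1.symm
  have hN1 : Module.finrank (ResidueField A)[X] (TorModule hφ 1 (Fin r → ResidueQuotient φ x y)) =
      2 * r := by
    rw [E1.finrank_eq]
    simp [Module.finrank_pi_fintype, mul_comm]
  have : Module.Finite (ResidueField A)[X] (TorModule hφ 0 (ResidueQuotient φ x y)) :=
    Module.Finite.of_surjective f0 hf0
  have : Module.Finite (ResidueField A)[X] (TorModule hφ 0 (Fin r → ResidueQuotient φ x y)) :=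
    Module.Finite.equiv (torPiEquiv hφ 0).symm
  have hN0 :
      Module.finrank (ResidueField A)[X] (TorModule hφ 0 (Fin r → ResidueQuotient φ x y)) ≤ r := by
    let F0 : (Fin r → (ResidueField A)[X]) →ₗ[(ResidueField A)[X]]
        (Fin r → TorModule hφ 0 (ResidueQuotient φ x y)) := f0.compLeft (Fin r)
    have hF0 : Function.Surjective F0 := hf0.comp_left
    rw [(torPiEquiv hφ 0).finrank_eq]
    refine (LinearMap.finrank_le_finrank_of_surjective hF0).trans ?_
    simp
  -- Let `ρ` be the rank of `Tor_1(k, N) → Tor_1(k, M)`, where `N` is the power of `A[X]_φ ⊗_A k`.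
  -- The long exact sequence gives `h_2(M ⧸ K) ≥ 2 r - ρ` and `h_1(M ⧸ K) ≤ (h_1(M) - ρ) + r`.
  have hrk2 := finrank_range_add_finrank_ker_of_isDomain
    (V := TorModule hφ 2 (M ⧸ LinearMap.range g)) (δ 1)
  have hrk1 := finrank_range_add_finrank_ker_of_isDomain (torMap hφ 1 g)
  have hrk1' := finrank_range_add_finrank_ker_of_isDomain (torMap hφ 1 (LinearMap.range g).mkQ)
  have hrk0 := finrank_range_add_finrank_ker_of_isDomain
    (V := TorModule hφ 1 (M ⧸ LinearMap.range g)) (δ 0)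
  rw [← LinearMap.exact_iff.mp (ex1 1)] at hrk2
  rw [LinearMap.exact_iff.mp (ex2 1)] at hrk1'
  rw [LinearMap.exact_iff.mp (ex3 0)] at hrk0
  have hle0 : Module.finrank (ResidueField A)[X] (LinearMap.range (δ 0)) ≤ r :=
    (Submodule.finrank_le _).trans hN0
  have hle1 : Module.finrank (ResidueField A)[X] (LinearMap.range (torMap hφ 1 g)) ≤
      Module.finrank (ResidueField A)[X] (TorModule hφ 1 M) := Submodule.finrank_le _
  have hkey (s) : ∃ t₀ ∈ Submodule.torsion (ResidueField A)[X] (TorModule hφ 2 M),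
      torMap hφ 2 (LinearMap.range g).mkQ s = torMap hφ 2 (LinearMap.range g).mkQ t₀ := by
    obtain ⟨c, hc⟩ := htspan s
    refine ⟨_, hc, ?_⟩
    -- the free part of `Tor_2(k, M)` dies in the quotient
    obtain ⟨s', hs'⟩ := (hrange (∑ j, c j • t j)).mpr ⟨c, rfl⟩
    rw [map_sub, ← hs', (ex2 2).apply_apply_eq_zero, sub_zero]
  refine ⟨LinearMap.range g, ?_, fpQ, by lia, by lia, ?_, hkey, ?_⟩
  · intro h
    have hz : torMap hφ 2 g = 0 := by rw [LinearMap.range_eq_bot.mp h, torMap_zero]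
    have h0 : t ⟨0, by lia⟩ = 0 := by
      obtain ⟨s, hs⟩ := (hrange (t ⟨0, by lia⟩)).mpr ⟨Pi.single ⟨0, by lia⟩ 1, by
        simp [Pi.single_apply]⟩
      rw [← hs, hz, LinearMap.zero_apply]
    have h1 := congrFun (hlin (Pi.single ⟨0, by lia⟩ 1) (by simp [Pi.single_apply, h0]))
      ⟨0, by lia⟩
    simp at h1
  · intro s hs hs0
    obtain ⟨c, rfl⟩ := (hrange s).mp ((ex2 2 s).mp hs0)
    simp [ht0 c hs]
  · intro s hs
    -- the connecting map kills torsion, its target being free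
    have hs0 : δ 1 s = 0 := by
      obtain ⟨f, hf⟩ := hs
      refine E1.map_eq_zero_iff.mp ?_
      have h : (f : (ResidueField A)[X]) • E1 (δ 1 s) = 0 := by
        rw [← map_smul, ← map_smul, show (f : (ResidueField A)[X]) • s = 0 from hf, map_zero,
          map_zero]
      exact (smul_eq_zero.mp h).resolve_left (nonZeroDivisors.coe_ne_zero f)
    obtain ⟨s', rfl⟩ := (ex3 1 s).mp hs0
    obtain ⟨t₀, ht₀, h⟩ := hkey s'
    exact ⟨t₀, ht₀, h.symm⟩

end Step

/-! ### Iterating the construction -/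

section Iterate

open TwistedPolynomial

variable {A : Type u} [CommRing A] [IsLocalRing A] {φ : A →+* A} [IsLocalHom φ]
  (hφ : ResidueField.map φ = RingHom.id (ResidueField A)) {x y : A}

/-- The isomorphism on Tor groups induced by an isomorphism of modules. -/
def torCongr (n : ℕ) {M N : Type u} [AddCommGroup M] [Module (TwistedPolynomial φ) M]
    [AddCommGroup N] [Module (TwistedPolynomial φ) N] (e : M ≃ₗ[TwistedPolynomial φ] N) :
    TorModule hφ n M ≃ₗ[(ResidueField A)[X]] TorModule hφ n N :=
  LinearEquiv.ofLinearMap (torMap hφ n e.toLinearMap) (torMap hφ n e.symm.toLinearMap)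
    (by rw [← torMap_comp, LinearEquiv.comp_symm, torMap_id])
    (by rw [← torMap_comp, LinearEquiv.symm_comp, torMap_id])

variable {M : Type u} [AddCommGroup M] [Module (TwistedPolynomial φ) M]

/-- The submodules `K` for which the torsion of `Tor_2(k, M)` maps bijectively onto the torsion of
`Tor_2(k, M ⧸ K)` and to whose quotient the construction of a larger submodule applies. -/
structure IsTorsionQuotient (K : Submodule (TwistedPolynomial φ) M) : Prop where
  finitePresentation : Module.FinitePresentation (TwistedPolynomial φ) (M ⧸ K)
  finrank_le : Module.finrank (ResidueField A)[X] (TorModule hφ 1 (M ⧸ K)) ≤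
    Module.finrank (ResidueField A)[X] (TorModule hφ 2 (M ⧸ K))
  finrank_pos : 0 < Module.finrank (ResidueField A)[X] (TorModule hφ 2 (M ⧸ K))
  eq_zero : ∀ t ∈ Submodule.torsion (ResidueField A)[X] (TorModule hφ 2 M),
    torMap hφ 2 K.mkQ t = 0 → t = 0
  exists_eq : ∀ t ∈ Submodule.torsion (ResidueField A)[X] (TorModule hφ 2 (M ⧸ K)),
    ∃ t₀ ∈ Submodule.torsion (ResidueField A)[X] (TorModule hφ 2 M), torMap hφ 2 K.mkQ t₀ = t

theorem LinearMap.map_mem_torsion {S V W : Type*} [CommRing S] [AddCommGroup V] [Module S V]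
    [AddCommGroup W] [Module S W] (f : V →ₗ[S] W) {v : V} (hv : v ∈ Submodule.torsion S V) :
    f v ∈ Submodule.torsion S W := by
  obtain ⟨a, ha⟩ := hv
  exact ⟨a, by rw [← LinearMap.map_smul_of_tower, ha, map_zero]⟩

variable {hφ}

theorem IsTorsionQuotient.bot [Module.FinitePresentation (TwistedPolynomial φ) M]
    (h12 : Module.finrank (ResidueField A)[X] (TorModule hφ 1 M) ≤
      Module.finrank (ResidueField A)[X] (TorModule hφ 2 M))
    (h2 : 0 < Module.finrank (ResidueField A)[X] (TorModule hφ 2 M)) :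
    IsTorsionQuotient hφ (⊥ : Submodule (TwistedPolynomial φ) M) := by
  let e := (Submodule.quotEquivOfEqBot (⊥ : Submodule (TwistedPolynomial φ) M) rfl).symm
  have he (t : TorModule hφ 2 M) : torMap hφ 2 (Submodule.mkQ ⊥) t = torCongr hφ 2 e t := rfl
  refine ⟨?_, ?_, ?_, fun t _ h ↦ ?_, fun t ht ↦ ?_⟩
  · exact Module.FinitePresentation.of_equiv e
  · rwa [← (torCongr hφ 1 e).finrank_eq, ← (torCongr hφ 2 e).finrank_eq]
  · rwa [← (torCongr hφ 2 e).finrank_eq]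
  · exact (torCongr hφ 2 e).map_eq_zero_iff.mp ((he t).symm.trans h)
  · refine ⟨(torCongr hφ 2 e).symm t,
      (torCongr hφ 2 e).symm.toLinearMap.map_mem_torsion ht, ?_⟩
    rw [he, LinearEquiv.apply_symm_apply]

/-- The construction applied to `M ⧸ K`, pulled back to `M`. An element of `M` whose class in
`M ⧸ K` lies in the socle agrees modulo the larger submodule `K'` with the socle element of a
torsion class of `Tor_2(k, M)`. -/
theorem IsTorsionQuotient.exists_lt [IsNoetherianRing A] (η : SocleMap hφ x y)
    (hxy : maximalIdeal A = Ideal.span {x, y}) (hreg : IsRegularPair x y) (hflat : φ.Flat)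
    (hrad : ∃ k, maximalIdeal A ^ k ≤ (maximalIdeal A).map φ)
    {K : Submodule (TwistedPolynomial φ) M} (hK : IsTorsionQuotient hφ K) :
    ∃ K', K < K' ∧ IsTorsionQuotient hφ K' ∧
      ∀ m : M, const φ x • m ∈ K → const φ y • m ∈ K →
        ∃ t₀ ∈ Submodule.torsion (ResidueField A)[X] (TorModule hφ 2 M),
          K'.mkQ (η.toFun M t₀) = K'.mkQ m := by
  have := hK.finitePresentation
  obtain ⟨L, hL, h1, h2, h3, h4, h5, h6⟩ := η.exists_submodule hxy hreg hflat hrad (M ⧸ K)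
    hK.finrank_le hK.finrank_pos
  let p : M →ₗ[TwistedPolynomial φ] (M ⧸ K) ⧸ L := L.mkQ ∘ₗ K.mkQ
  have hp : Function.Surjective p := L.mkQ_surjective.comp K.mkQ_surjective
  let e : ((M ⧸ K) ⧸ L) ≃ₗ[TwistedPolynomial φ] M ⧸ LinearMap.ker p :=
    (p.quotKerEquivOfSurjective hp).symm
  have hep : (LinearMap.ker p).mkQ = e.toLinearMap ∘ₗ L.mkQ ∘ₗ K.mkQ := by
    refine LinearMap.ext fun m ↦ ?_
    exact ((LinearEquiv.symm_apply_eq _).mpr rfl).symm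
  have hTep (t) : torMap hφ 2 (LinearMap.ker p).mkQ t =
      torCongr hφ 2 e (torMap hφ 2 L.mkQ (torMap hφ 2 K.mkQ t)) := by
    rw [hep, torMap_comp, torMap_comp]
    rfl
  refine ⟨LinearMap.ker p, ?_, ⟨Module.FinitePresentation.of_equiv e, ?_, ?_, fun t ht h ↦ ?_,
    fun t ht ↦ ?_⟩, fun m hx hy ↦ ?_⟩
  · refine SetLike.lt_iff_le_and_exists.mpr ⟨fun m hm ↦ ?_, ?_⟩
    · change L.mkQ (K.mkQ m) = 0
      rw [show K.mkQ m = 0 from (Submodule.Quotient.mk_eq_zero K).mpr hm, map_zero]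
    · obtain ⟨l, hl, hl0⟩ := L.ne_bot_iff.mp hL
      obtain ⟨m, rfl⟩ := K.mkQ_surjective l
      exact ⟨m, (Submodule.Quotient.mk_eq_zero L).mpr hl,
        fun hm ↦ hl0 ((Submodule.Quotient.mk_eq_zero K).mpr hm)⟩
  · rwa [← (torCongr hφ 1 e).finrank_eq, ← (torCongr hφ 2 e).finrank_eq]
  · rwa [← (torCongr hφ 2 e).finrank_eq]
  · rw [hTep, LinearEquiv.map_eq_zero_iff] at h
    exact hK.eq_zero t ht (h4 _ ((torMap hφ 2 K.mkQ).map_mem_torsion ht) h)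
  · obtain ⟨t', ht', h'⟩ := h6 _ ((torCongr hφ 2 e).symm.toLinearMap.map_mem_torsion ht)
    obtain ⟨t₀, ht₀, rfl⟩ := hK.exists_eq t' ht'
    refine ⟨t₀, ht₀, ?_⟩
    rw [hTep, h']
    exact LinearEquiv.apply_symm_apply _ _
  · obtain ⟨t, ht⟩ := η.exists_eq (K.mkQ m)
      (by rw [← map_smul]; exact (Submodule.Quotient.mk_eq_zero K).mpr hx)
      (by rw [← map_smul]; exact (Submodule.Quotient.mk_eq_zero K).mpr hy)
    obtain ⟨t', ht', h'⟩ := h5 t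
    obtain ⟨t₀, ht₀, rfl⟩ := hK.exists_eq t' ht'
    refine ⟨t₀, ht₀, ?_⟩
    rw [← η.naturality, hTep, ← h', hep]
    change η.toFun _ (torMap hφ 2 e.toLinearMap _) = e.toLinearMap (L.mkQ (K.mkQ m))
    rw [η.naturality, η.naturality, ht]

theorem Submodule.not_fg_iSup_of_strictMono {S N : Type*} [Ring S] [AddCommGroup N] [Module S N]
    {K : ℕ → Submodule S N} (hK : StrictMono K) : ¬ (⨆ n, K n).FG := by
  intro h
  obtain ⟨s, hs⟩ := h
  have hmem : ∀ v ∈ s, ∃ n, v ∈ K n := fun v hv ↦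
    (Submodule.mem_iSup_of_directed K hK.monotone.directed_le).mp (hs ▸ Submodule.subset_span hv)
  choose! n hn using hmem
  have hle : ⨆ n, K n ≤ K (s.sup n) := by
    rw [← hs]
    exact Submodule.span_le.mpr fun v hv ↦ hK.monotone (Finset.le_sup hv) (hn v hv)
  exact (hK (Nat.lt_succ_self _)).not_ge ((le_iSup K _).trans hle)

/-- The union of an increasing sequence of submodules obtained by iterating the construction. Both
injectivity and surjectivity are checked on socle elements: whether such an element vanishes, or
is a socle element, in the quotient by the union is decided at a finite stage. -/
theorem IsTorsionQuotient.exists_not_fg [IsNoetherianRing A] (η : SocleMap hφ x y)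
    (hxy : maximalIdeal A = Ideal.span {x, y}) (hreg : IsRegularPair x y) (hflat : φ.Flat)
    (hrad : ∃ k, maximalIdeal A ^ k ≤ (maximalIdeal A).map φ)
    (h : IsTorsionQuotient hφ (⊥ : Submodule (TwistedPolynomial φ) M)) :
    ∃ N : Submodule (TwistedPolynomial φ) M, ¬ N.FG ∧
      Function.Bijective ((torMap hφ 2 N.mkQ).domRestrict
        (Submodule.torsion (ResidueField A)[X] (TorModule hφ 2 M))) := by
  choose f hlt hf hsoc using fun K : {K : Submodule (TwistedPolynomial φ) M //
    IsTorsionQuotient hφ K} ↦ K.2.exists_lt η hxy hreg hflat hrad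
  let K' (n : ℕ) : {K : Submodule (TwistedPolynomial φ) M // IsTorsionQuotient hφ K} :=
    Nat.rec ⟨⊥, h⟩ (fun _ K ↦ ⟨f K, hf K⟩) n
  let K (n : ℕ) : Submodule (TwistedPolynomial φ) M := (K' n).1
  have hmono : StrictMono K := strictMono_nat_of_lt_succ fun n ↦ hlt (K' n)
  have hmem (m : M) : m ∈ ⨆ n, K n ↔ ∃ n, m ∈ K n :=
    Submodule.mem_iSup_of_directed K hmono.monotone.directed_le
  refine ⟨⨆ n, K n, Submodule.not_fg_iSup_of_strictMono hmono,
    (injective_iff_map_eq_zero _).mpr fun t ht ↦ Subtype.ext ?_, fun t ↦ ?_⟩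
  · have h0 : (⨆ n, K n).mkQ (η.toFun M t) = 0 := by
      rw [← η.naturality, show torMap hφ 2 (⨆ n, K n).mkQ t = 0 from ht, map_zero]
    obtain ⟨n, hn⟩ := (hmem _).mp ((Submodule.Quotient.mk_eq_zero _).mp h0)
    refine (K' n).2.eq_zero t t.2 (η.injective _ ?_)
    rw [η.naturality, map_zero]
    exact (Submodule.Quotient.mk_eq_zero _).mpr hn
  · obtain ⟨m, hm⟩ := (⨆ n, K n).mkQ_surjective (η.toFun _ t)
    have hx : const φ x • m ∈ ⨆ n, K n := by
      rw [← Submodule.Quotient.mk_eq_zero, ← Submodule.mkQ_apply, map_smul, hm]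
      exact (η.const_smul t).1
    have hy : const φ y • m ∈ ⨆ n, K n := by
      rw [← Submodule.Quotient.mk_eq_zero, ← Submodule.mkQ_apply, map_smul, hm]
      exact (η.const_smul t).2
    obtain ⟨n, hn⟩ := (hmem _).mp hx
    obtain ⟨n', hn'⟩ := (hmem _).mp hy
    -- `m` represents a socle element at the stage `max n n'`, so the next stage supplies a class
    obtain ⟨t₀, ht₀, h'⟩ := hsoc (K' (max n n')) m (hmono.monotone (le_max_left _ _) hn)
      (hmono.monotone (le_max_right _ _) hn')
    refine ⟨⟨t₀, ht₀⟩, η.injective _ ?_⟩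
    change η.toFun _ (torMap hφ 2 _ t₀) = _
    rw [η.naturality, ← hm]
    have h'' : η.toFun M t₀ - m ∈ K (max n n' + 1) := (Submodule.Quotient.eq _).mp h'
    exact (Submodule.Quotient.eq _).mpr ((hmem _).mpr ⟨max n n' + 1, h''⟩)

end Iterate

/-! ### Admissible quotients -/

theorem IsLocallyArtinian.of_surjective {A M N : Type u} [CommRing A] [AddCommGroup M]
    [Module A M] [AddCommGroup N] [Module A N] (h : IsLocallyArtinian A M) (f : M →ₗ[A] N)
    (hf : Function.Surjective f) : IsLocallyArtinian A N := by
  intro L hL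
  obtain ⟨n, s, rfl⟩ := Submodule.fg_iff_exists_fin_generating_family.mp hL
  choose v hv using fun i ↦ hf (s i)
  have hart := h (Submodule.span A (Set.range v)) (Submodule.fg_span (Set.finite_range v))
  have hmap : (Submodule.span A (Set.range v)).map f = Submodule.span A (Set.range s) := by
    rw [Submodule.map_span, ← Set.range_comp]
    exact congrArg (fun s ↦ Submodule.span A (Set.range s)) (funext hv)
  rw [← hmap]
  exact isArtinian_of_surjective _ (f.submoduleMap _) (f.submoduleMap_surjective _)

end

theorem mainTheorem3 (A : Type u) [CommRing A] [IsRegularLocalRing A]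
    [IsAdicComplete (maximalIdeal A) A] (hA : ringKrullDim A = 2)
    (φ : A →+* A) (hflat : φ.Flat) [IsLocalHom φ]
    (hφ : ResidueField.map φ = RingHom.id (ResidueField A))
    (M : ModuleCat.{u} (TwistedPolynomial φ))
    (hfp : Module.FinitePresentation (TwistedPolynomial φ) M)
    (hsmooth : IsLocallyArtinian A ((underlying φ).obj M))
    (hχ : eulerChar φ hφ M = 0) (h0 : torRank φ hφ 0 M = 0) :
    IsAdmissible A 2 ((underlying φ).obj M) ∨
      ∃ N : Submodule (TwistedPolynomial φ) M,
        ¬ N.FG ∧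
        Function.Bijective
          (((torTwisted φ hφ 2).map (ModuleCat.ofHom N.mkQ)).hom.domRestrict
            (Submodule.torsion (ResidueField A)[X] ((torTwisted φ hφ 2).obj M))) ∧
        IsAdmissible A 2
          ((underlying φ).obj (ModuleCat.of (TwistedPolynomial φ) (M ⧸ N))) ∧
        Module.Finite (TwistedPolynomial φ) (M ⧸ N) ∧
        ¬ Module.FinitePresentation (TwistedPolynomial φ) (M ⧸ N) := by
  obtain ⟨x, y, hxy, hreg⟩ := exists_isRegularPair hA
  obtain ⟨η⟩ := nonempty_socleMap hφ hxy hreg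
  have hrad : ∃ k, maximalIdeal A ^ k ≤ (maximalIdeal A).map φ :=
    Ideal.exists_pow_le_of_le_radical_of_fg
      (maximalIdeal_le_radical_map_of_flat φ hflat le_rfl) (IsNoetherian.noetherian _)
  have h12 := torRank_one_eq_torRank_two hφ hxy hreg M hχ h0
  rw [torRank_eq_finrank, torRank_eq_finrank] at h12
  have hfin : Module.Finite (ResidueField A)[X] ((torTwisted φ hφ 2).obj M) :=
    finite_tor_of_finitePresentation hφ hxy hflat 2 M
  obtain h2 | h2 := Nat.eq_zero_or_pos
    (Module.finrank (ResidueField A)[X] ((torTwisted φ hφ 2).obj M))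
  · exact Or.inl (isAdmissible_of_isTorsion hφ hsmooth
      (Module.finrank_eq_zero_iff_isTorsion.mp h2))
  · obtain ⟨N, hN, hbij⟩ := (IsTorsionQuotient.bot (M := M) h12.le h2).exists_not_fg η hxy hreg
      hflat hrad
    refine Or.inr ⟨N, hN, hbij, ?_, inferInstance, fun hfpN ↦ hN ?_⟩
    · have hfin' : Module.Finite (ResidueField A)[X] ((torTwisted φ hφ 2).obj
          (ModuleCat.of (TwistedPolynomial φ) (M ⧸ N))) := Module.Finite.of_surjective _ hbij.2
      refine isAdmissible_of_isTorsion hφ (hsmooth.of_surjective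
        ((underlying φ).map (ModuleCat.ofHom N.mkQ)).hom N.mkQ_surjective) fun t ↦ ?_
      obtain ⟨t₀, rfl⟩ := hbij.2 t
      exact (torMap hφ 2 N.mkQ).map_mem_torsion t₀.2
    · rw [← N.ker_mkQ]
      exact Module.FinitePresentation.fg_ker N.mkQ N.mkQ_surjective
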